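/- Consider the plant $\dot x(t)=Ax(t)+Bu(t)+d(t)$ with $x(t)\in\mathbb R^n$, $u(t)\in\mathbb R^m$, $n,m\ge 1$, real matrices $A,B$, and a disturbance $d:\mathbb R_{\ge 0}\to\mathbb R^n$ that is Lebesgue measurable and bounded. Norms $|\cdot|$ are Euclidean, $\|\cdot\|$ is the induced 2-norm of matrices, $\|d\|_{[0,t]}=\sup_{s\in[0,t]}|d(s)|$, and $\succ,\prec,\succeq,\preceq$ refer to symmetric matrices. Data. Let $U_0\in\mathbb R^{m\times T}$, $X_0,X_1,D_0\in\mathbb R^{n\times T}$ be the matrices whose columns are the off-line samples of $u$, $x$, $\dot x$, $d$ at the times $0,T_s,\dots,(T-1)T_s$ ($T_s>0$), where the samples satisfy $\dot x=Ax+Bu+d$ at these times. Suppose (i) $\begin{bmatrix}U_0\\X_0\end{bmatrix}$ has full row rank, and $D_0D_0^\top\preceq\Delta\Delta^\top$ for a given $\Delta\in\mathbb R^{n\times s}$; (ii) $\Omega\succ0$, and $\epsilon>0$, $Y\in\mathbb R^{T\times n}$ satisfy $$\begin{bmatrix}X_1Y+(X_1Y)^\top+\Omega+\epsilon\Delta\Delta^\top&Y^\top\\Y&-\epsilon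 I\end{bmatrix}\prec0,\qquad X_0Y\succ0;$$ put $S=(X_0Y)^{-1}$, $K=U_0Y(X_0Y)^{-1}$ and $V(x)=x^\top Sx$. Let $G,L\in\mathbb R^{T\times n}$ be any solutions of $U_0G=K$, $X_0G=I$ and of $U_0L=K$, $X_0L=0$, and let $[\,J_0\ \ V_0\,]$ (with $J_0\in\mathbb R^{T\times m}$, $V_0\in\mathbb R^{T\times n}$) be a right inverse of $\begin{bmatrix}U_0\\X_0\end{bmatrix}$. Let $\omega_1$ be the smallest eigenvalue of $S\Omega S$, $\omega_2=2\|SX_1L\|+2\|S\|\|\Delta\|\|L\|$, let $\sigma>0$ satisfy $\sigma\omega_2<\omega_1$, and put $c_A=\|X_1V_0\|+\|\Delta\|\|V_0\|$, $c_\Phi=\|X_1G\|+\|\Delta\|\|G\|$ and $$\tau_d(\sigma)=\frac1{c_A}\log\Big(\frac{\sigma}{1+\sigma}\,\frac{c_A}{\max\{c_\Phi,1\}}+1\Big)\ \text{ if } c_A\ne0,\qquad \tau_d(\sigma)=\frac{\sigma}{1+\sigma}\,\frac1{\max\{c_\Phi,1\}}\ \text{ if } c_A=0 .$$ Closed loop.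 For $\varsigma_d>0$ and $\nu\ge0$ consider $$\dot x(t)=(A+BK)x(t)+BKe(t)+d(t),\qquad e(t)=x(t_k)-x(t)\ \text{ for } t\in[t_k,t_{k+1}),$$ $$\dot\eta(t)=-\varsigma_d\,\eta(t)+\nu,\qquad \eta(0)\ge V(x(0)),$$ where $t_0=0$ and $t_{k+1}=\inf\{t:\ t\ge t_k+\tau_d(\sigma)\text{ and }V(x(t))\ge\eta(t)\}$, with $\inf\emptyset=+\infty$. Solutions are understood in the Carathéodory sense, on an interval of nonnegative times containing $0$; $x$ and $\eta$ do not jump at the instants $t_k$. Claim. The closed loop is practically exponentially ISS in $(x,\sqrt\eta)$ (and exponentially ISS when $\nu=0$): for each $\varsigma_d>0$ there are $c_1\ge1$ and $c_2,c_3,\kappa>0$, independent of $\nu$, such that for every $\nu\ge0$ there is $c_4>0$ with $c_4\,\nu\le\kappa\sqrt\nu$ for which every solution $(x,\eta)$ with any disturbance $d$ satisfies $\eta(t)\ge0$ and $$|(x(t),\sqrt{\eta(t)})|\le c_1e^{-c_2t}\,|(x(0),\sqrt{\eta(0)})|+c_3\|d\|_{[0,t]}+c_4\,\nu$$ for all $t$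 in its domain; moreover every maximal solution is defined on all of $[0,\infty)$. -/

import Mathlib

open scoped Matrix.Norms.L2Operator

noncomputable section

/-- The `p × T` matrix whose `j`-th column is the sample `f (j * Ts)`, `j = 0, …, T - 1`. -/
def sampleMatrix {p : ℕ} (T : ℕ) (Ts : ℝ) (f : ℝ → EuclideanSpace ℝ (Fin p)) :
    Matrix (Fin p) (Fin T) ℝ :=
  Matrix.of fun i j => f ((j : ℕ) * Ts) i

/-- The left-hand side of the linear matrix inequality used in the design:
`[X₁Y + (X₁Y)ᵀ + Ω + ε ΔΔᵀ, Yᵀ; Y, -ε I]`. -/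
def designMatrix {n T s : ℕ} (X₁ : Matrix (Fin n) (Fin T) ℝ) (Δ : Matrix (Fin n) (Fin s) ℝ)
    (Ω : Matrix (Fin n) (Fin n) ℝ) (ε : ℝ) (Y : Matrix (Fin T) (Fin n) ℝ) :
    Matrix (Fin n ⊕ Fin T) (Fin n ⊕ Fin T) ℝ :=
  Matrix.fromBlocks
    (X₁ * Y + (X₁ * Y).transpose + Ω + ε • (Δ * Δ.transpose)) Y.transpose
    Y (-(ε • (1 : Matrix (Fin T) (Fin T) ℝ)))

/-- `ω₁`: the smallest eigenvalue of (the symmetric matrix) `S Ω S`. -/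
def omegaOne {n : ℕ} (S Ω : Matrix (Fin n) (Fin n) ℝ) : ℝ :=
  sInf (spectrum ℝ (S * Ω * S))

/-- `ω₂ = 2 ‖S X₁ L‖ + 2 ‖S‖ ‖Δ‖ ‖L‖`, with the induced 2-norm. -/
def omegaTwo {n T s : ℕ} (S : Matrix (Fin n) (Fin n) ℝ) (X₁ : Matrix (Fin n) (Fin T) ℝ)
    (L : Matrix (Fin T) (Fin n) ℝ) (Δ : Matrix (Fin n) (Fin s) ℝ) : ℝ :=
  2 * ‖S * X₁ * L‖ + 2 * ‖S‖ * ‖Δ‖ * ‖L‖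

/-- `‖X₁ N‖ + ‖Δ‖ ‖N‖`, with the induced 2-norm. It is `c_A` for `N = V₀` and `c_Φ` for `N = G`. -/
def dataBound {n T s : ℕ} (X₁ : Matrix (Fin n) (Fin T) ℝ) (Δ : Matrix (Fin n) (Fin s) ℝ)
    (N : Matrix (Fin T) (Fin n) ℝ) : ℝ :=
  ‖X₁ * N‖ + ‖Δ‖ * ‖N‖

/-- The enforced waiting time `τ_d(σ)`. If `c_A = 0`, the formula is read as its limit
for `c_A → 0`. -/
def waitingTime (cA cΦ σ : ℝ) : ℝ :=
  if cA = 0 then σ / (1 + σ) * (1 / max cΦ 1)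
  else 1 / cA * Real.log (σ / (1 + σ) * (cA / max cΦ 1) + 1)

/-- `V(x) = xᵀ S x`. -/
def lyapunovV {n : ℕ} (S : Matrix (Fin n) (Fin n) ℝ) (x : EuclideanSpace ℝ (Fin n)) : ℝ :=
  x.ofLp ⬝ᵥ S.mulVec x.ofLp

/-- The transmission instants generated along `v = V ∘ x` and the threshold `η` on the time domain
`I`: `t₀ = 0`, and `t_{k+1}` is the infimum of all `t ∈ I` with `t ≥ t_k + τ` and `v t ≥ η t`
(`+∞` if there is none). -/
def triggerTime (I : Set ℝ) (τ : ℝ) (v η : ℝ → ℝ) : ℕ → EReal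
  | 0 => 0
  | k + 1 => sInf ((fun t : ℝ => (t : EReal)) ''
      {t : ℝ | t ∈ I ∧ triggerTime I τ v η k + (τ : EReal) ≤ (t : EReal) ∧ η t ≤ v t})

/-- `(x, η)` is a Carathéodory solution, on the interval `I ∋ 0` of nonnegative times, of
* `x' = (A + B K) x + B K e + d` with `e t = x t_k - x t` on `[t_k, t_{k+1})`,
* `η' = -ς η + ν` with `η 0 ≥ V (x 0)`,
* the transmission instants `t_k` being those of `triggerTime` with waiting time `τ`.
The differential equations are written in their integral form. -/
structure IsClosedLoopSolution {n m : ℕ} (A : Matrix (Fin n) (Fin n) ℝ)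
    (B : Matrix (Fin n) (Fin m) ℝ) (K : Matrix (Fin m) (Fin n) ℝ)
    (S : Matrix (Fin n) (Fin n) ℝ) (τ ς ν : ℝ) (d : ℝ → EuclideanSpace ℝ (Fin n))
    (I : Set ℝ) (x : ℝ → EuclideanSpace ℝ (Fin n)) (η : ℝ → ℝ) : Prop where
  ordConnected : I.OrdConnected
  zero_mem : (0 : ℝ) ∈ I
  subset_Ici : I ⊆ Set.Ici 0
  continuousOn_x : ContinuousOn x I
  continuousOn_η : ContinuousOn η I
  init : lyapunovV S (x 0) ≤ η 0
  flow_x : ∀ (k : ℕ) (tk : ℝ),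
    triggerTime I τ (fun r => lyapunovV S (x r)) η k = (tk : EReal) →
    ∀ t ∈ I, tk ≤ t →
      (t : EReal) ≤ triggerTime I τ (fun r => lyapunovV S (x r)) η (k + 1) →
      x t = x tk + ∫ r in tk..t,
        (Matrix.toEuclideanLin (A + B * K) (x r) +
          Matrix.toEuclideanLin (B * K) (x tk - x r) + d r)
  flow_η : ∀ t ∈ I, η t = η 0 + ∫ r in (0 : ℝ)..t, (-ς * η r + ν)

/-- A maximal solution: one that has no proper extension. -/
def IsMaximalSolution {n m : ℕ} (A : Matrix (Fin n) (Fin n) ℝ)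
    (B : Matrix (Fin n) (Fin m) ℝ) (K : Matrix (Fin m) (Fin n) ℝ)
    (S : Matrix (Fin n) (Fin n) ℝ) (τ ς ν : ℝ) (d : ℝ → EuclideanSpace ℝ (Fin n))
    (I : Set ℝ) (x : ℝ → EuclideanSpace ℝ (Fin n)) (η : ℝ → ℝ) : Prop :=
  IsClosedLoopSolution A B K S τ ς ν d I x η ∧
    ∀ (I' : Set ℝ) (x' : ℝ → EuclideanSpace ℝ (Fin n)) (η' : ℝ → ℝ),
      IsClosedLoopSolution A B K S τ ς ν d I' x' η' → I ⊆ I' →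
      Set.EqOn x x' I → Set.EqOn η η' I → I' = I

/-- An admissible disturbance: Lebesgue measurable and bounded on `[0, ∞)`. -/
def IsDisturbance {n : ℕ} (d : ℝ → EuclideanSpace ℝ (Fin n)) : Prop :=
  AEMeasurable d (MeasureTheory.volume.restrict (Set.Ici 0)) ∧ ∃ δ : ℝ, ∀ t : ℝ, 0 ≤ t → ‖d t‖ ≤ δ

/-- `‖d‖_{[0,t]} = sup_{s ∈ [0,t]} |d s|`. -/
def supNorm {n : ℕ} (d : ℝ → EuclideanSpace ℝ (Fin n)) (t : ℝ) : ℝ :=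
  sSup ((fun r => ‖d r‖) '' Set.Icc 0 t)

/-- The Euclidean norm `|(x, r)|` of the concatenated vector. -/
def pairNorm {n : ℕ} (x : EuclideanSpace ℝ (Fin n)) (r : ℝ) : ℝ :=
  √(‖x‖ ^ 2 + r ^ 2)

end

/-!
The plant enters only through the identity `X₁ - D₀ = A X₀ + B U₀`, which gives `A + B K = (X₁ - D₀) G`,
`B K = (X₁ - D₀) L` and `A = (X₁ - D₀) V₀`. Since `D₀ D₀ᵀ ⪯ Δ Δᵀ` forces `‖D₀‖ ≤ ‖Δ‖`, the data
bounds are upper bounds: `‖A‖ ≤ c_A`, `‖A + B K‖ ≤ c_Φ`, `2 ‖S B K‖ ≤ ω₂`. Testing the linear matrix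
inequality on `(w, ε⁻¹ Y w)` with `w = S v`, and absorbing the cross term in `D₀` by Young's inequality,
yields `2 ⟪S v, (A + B K) v⟫ ≤ -ω₁ ‖v‖²` (`closedLoop_quadratic_le`).

During a waiting period that starts at `t_k`, the error `e = x(t_k) - x` satisfies
`‖e(t)‖ ≤ ∫ (c_A ‖e‖ + c_Φ ‖x(t_k)‖ + ‖d‖)`, and the waiting time is exactly the one for which
Grönwall's inequality gives `‖e‖ ≤ σ (‖x‖ + ‖d‖)` (`norm_sub_le_of_le_waitingTime`). As `σ ω₂ < ω₁`,
`V` then decays at a rate `c` up to a term `γ ‖d‖²`. The disturbance is merely measurable, so `V ∘ x`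
need not have one-sided derivatives; instead its upper right Dini derivative is bounded at *every* point
(`eventually_slope_quadratic_lt`), which is all that Grönwall's inequality needs.

After the waiting period and before the next transmission, `V ≤ η`. Both `η` and, across waiting periods,
`V` are dominated by the solution `z` of `z' = -c z + γ ‖d‖² + ν`, `z(0) = η(0)`, where `c ≤ ς`. Because
transmissions are at least `τ > 0` apart, induction on their number gives `V ≤ z` on the whole domain
(`IsClosedLoopSolution.lyapunovV_le`); square roots then turn this into the claimed estimate
(`pairNorm_sqrt_le`), with `c₄ ν` a multiple of `√ν`.

A solution on a bounded interval can be extended: on `[0, b)` it is bounded by the estimate, so its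
integral equation defines a value at `b`; on `[0, b]` the flow from the last transmission continues for
a short time during which no new transmission is triggered. In both cases the earlier transmission
instants do not change (`IsClosedLoopSolution.extend`). Hence maximal solutions live on `[0, ∞)`.
-/

/-! ### Integral equations with measurable forcing -/

section IntegralEquations

open MeasureTheory Set Filter Topology

variable {E : Type*} [NormedAddCommGroup E] [InnerProductSpace ℝ E]

/-- The upper right Dini derivative of `⟪x, S x⟫` at `t`, where `x' = w + d` in integral form, `w` is
continuous and `‖d‖ ≤ D`. No differentiability of `x` at `t` is needed: the difference quotient is
`⟪S (x t + x z), ·⟫` applied to the mean of `w + d` over `[t, z]`, and the mean of `w` converges to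
`w t` while that of `d` has norm at most `D`. -/
theorem eventually_slope_quadratic_lt [CompleteSpace E] {S : E →L[ℝ] E}
    (hS : ∀ u v, inner ℝ (S u) v = inner ℝ u (S v)) {x w d : ℝ → E} {t b D : ℝ} (htb : t < b)
    (hxc : ContinuousOn x (Icc t b)) (hw : ContinuousOn w (Icc t b))
    (hd : IntervalIntegrable d volume t b) (hD : ∀ r ∈ Icc t b, ‖d r‖ ≤ D)
    (hx : ∀ z ∈ Icc t b, x z = x t + ∫ r in t..z, (w r + d r)) {r : ℝ}
    (hr : 2 * inner ℝ (S (x t)) (w t) + 2 * ‖S (x t)‖ * D < r) :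
    ∀ᶠ z in 𝓝[>] t,
      (z - t)⁻¹ * (inner ℝ (x z) (S (x z)) - inner ℝ (x t) (S (x t))) < r := by
  have hmem : Icc t b ∈ 𝓝[>] t := Icc_mem_nhdsGT htb
  have hle : 𝓝[>] t ≤ 𝓝[Icc t b] t := by
    refine le_inf inf_le_left (le_principal_iff.2 hmem)
  have ht : t ∈ Icc t b := ⟨le_rfl, htb.le⟩
  have hxt : Tendsto x (𝓝[>] t) (𝓝 (x t)) := (hxc t ht).tendsto.mono_left hle
  have hP : HasDerivWithinAt (fun z => ∫ r in t..z, w r) (w t) (Ioi t) t := by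
    rw [hasDerivWithinAt_Ioi_iff_Ici]
    refine intervalIntegral.integral_hasDerivWithinAt_right (by simp) ?_ ?_
    · exact ⟨Icc t b, hmem, hw.aestronglyMeasurable measurableSet_Icc⟩
    · exact (hw t ht).tendsto.mono_left hle
  have hslope := (hasDerivWithinAt_iff_tendsto_slope' (by simp)).1 hP
  have hlim : Tendsto (fun z => inner ℝ (S (x t + x z)) (slope (fun z => ∫ r in t..z, w r) t z)
      + ‖S (x t + x z)‖ * D) (𝓝[>] t)
      (𝓝 (inner ℝ (S (x t + x t)) (w t) + ‖S (x t + x t)‖ * D)) := by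
    have h1 : Tendsto (fun z => S (x t + x z)) (𝓝[>] t) (𝓝 (S (x t + x t))) :=
      (S.continuous.tendsto _).comp (tendsto_const_nhds.add hxt)
    exact (h1.inner hslope).add (h1.norm.mul_const D)
  have heq : inner ℝ (S (x t + x t)) (w t) + ‖S (x t + x t)‖ * D
      = 2 * inner ℝ (S (x t)) (w t) + 2 * ‖S (x t)‖ * D := by
    rw [← two_smul ℝ (x t), map_smul, inner_smul_left, norm_smul]
    norm_num
  rw [heq] at hlim
  filter_upwards [hlim.eventually_lt_const hr, hmem, self_mem_nhdsWithin] with z hz hzI hzt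
  have hzt : 0 < z - t := sub_pos.2 hzt
  refine lt_of_le_of_lt ?_ hz
  have hsub : Icc t z ⊆ Icc t b := Icc_subset_Icc_right hzI.2
  have hwi : IntervalIntegrable w volume t z :=
    (hw.mono hsub).intervalIntegrable_of_Icc hzI.1
  have hdi : IntervalIntegrable d volume t z :=
    hd.mono_set (by rw [uIcc_of_le hzI.1, uIcc_of_le htb.le]; exact hsub)
  have hinc : x z - x t = (∫ r in t..z, w r) + ∫ r in t..z, d r := by
    rw [hx z hzI, intervalIntegral.integral_add hwi hdi]; abel
  have hquad : inner ℝ (x z) (S (x z)) - inner ℝ (x t) (S (x t))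
      = inner ℝ (S (x t + x z)) (x z - x t) := by
    simp only [map_add, inner_add_left, inner_sub_right]
    rw [hS (x t) (x t), hS (x z) (x z), hS (x z) (x t), ← real_inner_comm (x z) (S (x t))]
    ring
  have hdn : ‖∫ r in t..z, d r‖ ≤ D * (z - t) := by
    have := intervalIntegral.norm_integral_le_of_norm_le_const (a := t) (b := z) (f := d) (C := D)
      (fun r hr => hD r (by
        rw [uIoc_of_le hzI.1] at hr
        exact ⟨hr.1.le, hr.2.trans hzI.2⟩))
    rwa [abs_of_pos hzt] at this
  rw [hquad, hinc, inner_add_right, mul_add, slope_def_module]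
  simp only [intervalIntegral.integral_same, sub_zero, inner_smul_right]
  refine add_le_add_right ?_ _
  calc (z - t)⁻¹ * inner ℝ (S (x t + x z)) (∫ r in t..z, d r)
      ≤ (z - t)⁻¹ * (‖S (x t + x z)‖ * (D * (z - t))) := by
        gcongr
        exact (real_inner_le_norm _ _).trans (by gcongr)
    _ = ‖S (x t + x z)‖ * D := by field_simp

/-- Growth of the sampling error: with `e = x a - x`, the right-hand side of the equation is
`Φ (x a) - (Φ - N) e + d`. -/
theorem norm_sub_le_gronwallBound {Φ N : E →L[ℝ] E} {x d : ℝ → E} {a b D cA cΦ : ℝ}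
    (hxc : ContinuousOn x (Icc a b)) (hD : ∀ r ∈ Icc a b, ‖d r‖ ≤ D) (hcA : ‖Φ - N‖ ≤ cA) (hcΦ : ‖Φ‖ ≤ cΦ)
    (hx : ∀ t ∈ Icc a b, x t = x a + ∫ r in a..t, (Φ (x r) + N (x a - x r) + d r)) :
    ∀ t ∈ Icc a b, ‖x a - x t‖ ≤ gronwallBound 0 cA (cΦ * ‖x a‖ + D) (t - a) := by
  intro t₀ ht₀
  have hab : a ≤ b := ht₀.1.trans ht₀.2
  set C := cΦ * ‖x a‖ + D
  set g : ℝ → ℝ := fun r => cA * ‖x a - x r‖ + C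
  have hg : ContinuousOn g (Icc a b) := by fun_prop
  have hle : ∀ t ∈ Icc a b, ‖x a - x t‖ ≤ ∫ r in a..t, g r := by
    intro t ht
    have hsub : Icc a t ⊆ Icc a b := Icc_subset_Icc_right ht.2
    rw [hx t ht, sub_add_cancel_left, norm_neg]
    refine intervalIntegral.norm_integral_le_of_norm_le ht.1 ?_
      ((hg.mono hsub).intervalIntegrable_of_Icc ht.1)
    refine Eventually.of_forall fun r hr => ?_
    have hr : r ∈ Icc a b := hsub (Ioc_subset_Icc_self hr)
    have : Φ (x r) + N (x a - x r) + d r = Φ (x a) - (Φ - N) (x a - x r) + d r := by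
      simp only [sub_apply, map_sub]; abel
    rw [this]
    calc _ ≤ ‖Φ (x a)‖ + ‖(Φ - N) (x a - x r)‖ + ‖d r‖ :=
          (norm_add_le _ _).trans (by gcongr; exact norm_sub_le _ _)
      _ ≤ cΦ * ‖x a‖ + cA * ‖x a - x r‖ + D := by
          gcongr
          · exact Φ.le_of_opNorm_le hcΦ _
          · exact (Φ - N).le_of_opNorm_le hcA _
          · exact hD r hr
      _ = g r := by simp only [g, C]; ring
  refine (hle t₀ ht₀).trans ?_
  have hgi : ∀ t ∈ Icc a b, IntervalIntegrable g volume a t := fun t ht =>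
    (hg.mono (Icc_subset_Icc_right ht.2)).intervalIntegrable_of_Icc ht.1
  have hderiv : ∀ t ∈ Ico a b,
      HasDerivWithinAt (fun t => ∫ r in a..t, g r) (g t) (Ici t) t := by
    intro t ht
    have hmem : Icc a b ∈ 𝓝[>] t :=
      mem_of_superset (Icc_mem_nhdsGT ht.2) (Icc_subset_Icc_left ht.1)
    refine intervalIntegral.integral_hasDerivWithinAt_right (hgi t (Ico_subset_Icc_self ht)) ?_ ?_
    · exact ⟨Icc a b, hmem, hg.aestronglyMeasurable measurableSet_Icc⟩
    · exact (hg t (Ico_subset_Icc_self ht)).tendsto.mono_left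
        (le_inf inf_le_left (le_principal_iff.2 hmem))
  refine le_gronwallBound_of_liminf_deriv_right_le (f := fun t => ∫ r in a..t, g r) (f' := g)
    ?_ ?_ (by simp) ?_ t₀ ht₀
  · have := intervalIntegral.continuousOn_primitive_interval (f := g) (μ := volume) (a := a) (b := b)
      (by rw [uIcc_of_le hab]; exact hg.integrableOn_Icc)
    rwa [uIcc_of_le hab] at this
  · exact fun t ht r hr => (hderiv t ht).liminf_right_slope_le hr
  · intro t ht
    simp only [g]
    gcongr
    · exact (norm_nonneg _).trans hcA
    · exact hle t (Ico_subset_Icc_self ht)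

/-- Global solvability of `x' = A x + f`, `x a = x₀`, in integral form for integrable `f`. -/
theorem exists_affine_integral_solution [CompleteSpace E] (A : E →L[ℝ] E) (x₀ : E) {f : ℝ → E} {a : ℝ}
    (hf : ∀ b, IntervalIntegrable f volume a b) :
    ∃ x : ℝ → E, Continuous x ∧ ∀ t, x t = x₀ + ∫ r in a..t, (A (x r) + f r) := by
  set F : ℝ → E := fun t => ∫ r in a..t, f r
  have hF : Continuous F := intervalIntegral.continuous_primitive
    (fun b c => (hf b).symm.trans (hf c)) a
  -- `y = x - F` solves `y' = A (y + F)`, whose right-hand side is continuous in time.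
  set U : ℝ → E →L[ℝ] E := fun t => NormedSpace.exp (t • A)
  have hU : ∀ t, HasDerivAt U (A * U t) t := fun t => hasDerivAt_exp_smul_const' A t
  have hUinv : ∀ t, U t * U (-t) = 1 := by
    intro t
    let : NormedAlgebra ℚ (E →L[ℝ] E) := NormedAlgebra.restrictScalars ℚ ℝ _
    have := NormedSpace.exp_add_of_commute (𝔸 := E →L[ℝ] E) (x := t • A) (y := (-t) • A)
      (((Commute.refl A).smul_left t).smul_right (-t))
    rw [← add_smul, add_neg_cancel, zero_smul, NormedSpace.exp_zero] at this
    exact this.symm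
  have hUc : Continuous U := continuous_iff_continuousAt.2 fun t => (hU t).continuousAt
  set g : ℝ → E := fun t => U (-t) (A (F t))
  have hg : Continuous g := (hUc.comp continuous_neg).clm_apply (A.continuous.comp hF)
  set y : ℝ → E := fun t => U (t - a) x₀ + U t (∫ r in a..t, g r)
  have hy : ∀ t, HasDerivAt y (A (y t + F t)) t := by
    intro t
    have h1 : HasDerivAt (fun t => U (t - a) x₀) (A (U (t - a) x₀)) t := by
      have := ((hU (t - a)).comp_sub_const t a).clm_apply (hasDerivAt_const t x₀)
      simpa using this
    have h2 : HasDerivAt (fun t => U t (∫ r in a..t, g r))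
        (A (U t (∫ r in a..t, g r)) + A (F t)) t := by
      have := (hU t).clm_apply (intervalIntegral.integral_hasDerivAt_right
        (hg.intervalIntegrable a t) (hg.stronglyMeasurableAtFilter _ _) hg.continuousAt)
      have h3 : U t (g t) = A (F t) := by
        change (U t * U (-t)) (A (F t)) = _
        rw [hUinv]; rfl
      simpa [h3] using this
    have := h1.add h2
    rw [← add_assoc, ← map_add, ← map_add] at this
    exact this
  have hyc : Continuous y := continuous_iff_continuousAt.2 fun t => (hy t).continuousAt
  refine ⟨fun t => y t + F t, hyc.add hF, fun t => ?_⟩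
  have hAc : Continuous fun r => A (y r + F r) := A.continuous.comp (hyc.add hF)
  have hya : y a = x₀ := by simp [y, U]
  rw [intervalIntegral.integral_add (hAc.intervalIntegrable a t) (hf t),
    intervalIntegral.integral_eq_sub_of_hasDerivAt (fun r _ => hy r) (hAc.intervalIntegrable a t),
    hya]
  simp only [F]; abel

/-- The waiting time is the time at which the solution of `φ' = c_A φ + C`, `φ 0 = 0`, reaches
`σ / (1 + σ) * (C / max c_Φ 1)`. -/
theorem gronwallBound_waitingTime {cA cΦ σ C : ℝ} (hcA : 0 ≤ cA) (hσ : 0 < σ) :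
    gronwallBound 0 cA C (waitingTime cA cΦ σ) = σ / (1 + σ) * (C / max cΦ 1) := by
  have hm : 0 < max cΦ 1 := lt_max_of_lt_right one_pos
  rcases eq_or_ne cA 0 with rfl | h
  · rw [gronwallBound_K0, waitingTime, if_pos rfl]; field_simp; ring
  · rw [gronwallBound_of_K_ne_0 h, waitingTime, if_neg h]
    have : cA * (1 / cA * Real.log (σ / (1 + σ) * (cA / max cΦ 1) + 1))
      = Real.log (σ / (1 + σ) * (cA / max cΦ 1) + 1) := by field_simp
    simp only [this]
    rw [Real.exp_log (by positivity)]
    field_simp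
    ring

theorem waitingTime_pos {cA cΦ σ : ℝ} (hcA : 0 ≤ cA) (hσ : 0 < σ) : 0 < waitingTime cA cΦ σ := by
  have hm : 0 < max cΦ 1 := lt_max_of_lt_right one_pos
  rw [waitingTime]
  split_ifs with h
  · positivity
  · have hA : 0 < cA := lt_of_le_of_ne hcA (Ne.symm h)
    have h1 : 0 < σ / (1 + σ) * (cA / max cΦ 1) := by positivity
    exact mul_pos (by positivity) (Real.log_pos (by linarith))

/-- Throughout the waiting period the sampling error is small relative to the current state and the
disturbance. -/
theorem norm_sub_le_of_le_waitingTime {Φ N : E →L[ℝ] E} {x d : ℝ → E} {a b D cA cΦ σ : ℝ}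
    (hxc : ContinuousOn x (Icc a b)) (hD : ∀ r ∈ Icc a b, ‖d r‖ ≤ D) (hcA : ‖Φ - N‖ ≤ cA) (hcΦ : ‖Φ‖ ≤ cΦ) (hσ : 0 < σ)
    (hb : b - a ≤ waitingTime cA cΦ σ)
    (hx : ∀ t ∈ Icc a b, x t = x a + ∫ r in a..t, (Φ (x r) + N (x a - x r) + d r))
    {t : ℝ} (ht : t ∈ Icc a b) : ‖x a - x t‖ ≤ σ * (‖x t‖ + D) := by
  have hcA0 : 0 ≤ cA := (norm_nonneg _).trans hcA
  have hcΦ0 : 0 ≤ cΦ := (norm_nonneg _).trans hcΦ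
  have hD0 : 0 ≤ D := (norm_nonneg _).trans (hD t ht)
  have hm : 0 < max cΦ 1 := lt_max_of_lt_right one_pos
  have h1 : ‖x a - x t‖ ≤ σ / (1 + σ) * ((cΦ * ‖x a‖ + D) / max cΦ 1) := by
    rw [← gronwallBound_waitingTime hcA0 hσ]
    refine (norm_sub_le_gronwallBound hxc hD hcA hcΦ hx t ht).trans ?_
    exact gronwallBound_mono le_rfl (by positivity) hcA0 (by linarith [ht.2])
  have h2 : (cΦ * ‖x a‖ + D) / max cΦ 1 ≤ ‖x a‖ + D := by
    rw [div_le_iff₀ hm, add_mul]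
    have : cΦ * ‖x a‖ ≤ ‖x a‖ * max cΦ 1 := by
      rw [mul_comm]; gcongr; exact le_max_left _ _
    have : D ≤ D * max cΦ 1 := le_mul_of_one_le_right hD0 (le_max_right _ _)
    linarith
  have h3 : ‖x a‖ ≤ ‖x t‖ + ‖x a - x t‖ := norm_le_insert' (x a) (x t)
  have h4 : ‖x a - x t‖ ≤ σ / (1 + σ) * (‖x t‖ + ‖x a - x t‖ + D) := by
    refine h1.trans ?_
    gcongr
    linarith
  rw [div_mul_eq_mul_div, le_div_iff₀ (by positivity)] at h4
  linarith

end IntegralEquations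

/-! ### Matrix inequalities and data-based bounds -/

section MatrixInequalities

open Matrix

open scoped MatrixOrder in
theorem Matrix.IsHermitian.sInf_spectrum_mul_le {n : ℕ} {M : Matrix (Fin n) (Fin n) ℝ}
    (hM : M.IsHermitian) (v : Fin n → ℝ) :
    sInf (spectrum ℝ M) * (v ⬝ᵥ v) ≤ v ⬝ᵥ M *ᵥ v := by
  have hle : algebraMap ℝ (Matrix (Fin n) (Fin n) ℝ) (sInf (spectrum ℝ M)) ≤ M :=
    algebraMap_le_of_le_spectrum (ha := hM.isSelfAdjoint) fun c hc =>
      csInf_le M.finite_real_spectrum.bddBelow hc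
  have := (Matrix.le_iff.1 hle).dotProduct_mulVec_nonneg v
  simp only [star_trivial, sub_mulVec, dotProduct_sub, Algebra.algebraMap_eq_smul_one,
    smul_mulVec, one_mulVec, dotProduct_smul, smul_eq_mul] at this
  linarith

theorem Matrix.PosDef.sInf_spectrum_pos {n : ℕ} (hn : 0 < n) {M : Matrix (Fin n) (Fin n) ℝ}
    (hM : M.PosDef) : 0 < sInf (spectrum ℝ M) := by
  have hfin : (spectrum ℝ M).Finite := M.finite_real_spectrum
  have hne : (spectrum ℝ M).Nonempty :=
    ⟨_, hM.isHermitian.eigenvalues_mem_spectrum_real ⟨0, hn⟩⟩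
  have hmem := hne.csInf_mem hfin
  rw [hM.isHermitian.spectrum_real_eq_range_eigenvalues] at hmem ⊢
  obtain ⟨i, hi⟩ := hmem
  rw [← hi]
  exact hM.eigenvalues_pos i

theorem dotProduct_self_le_of_posSemidef {n p q : ℕ} {D : Matrix (Fin n) (Fin p) ℝ}
    {Δ : Matrix (Fin n) (Fin q) ℝ} (h : (Δ * Δᵀ - D * Dᵀ).PosSemidef) (w : Fin n → ℝ) :
    (Dᵀ *ᵥ w) ⬝ᵥ (Dᵀ *ᵥ w) ≤ (Δᵀ *ᵥ w) ⬝ᵥ (Δᵀ *ᵥ w) := by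
  have := h.dotProduct_mulVec_nonneg w
  simp only [star_trivial, sub_mulVec, dotProduct_sub, ← mulVec_mulVec] at this
  rw [dotProduct_mulVec w Δ, dotProduct_mulVec w D, ← mulVec_transpose, ← mulVec_transpose] at this
  linarith

theorem l2_opNorm_le_of_posSemidef {n p q : ℕ} {D : Matrix (Fin n) (Fin p) ℝ}
    {Δ : Matrix (Fin n) (Fin q) ℝ} (h : (Δ * Δᵀ - D * Dᵀ).PosSemidef) : ‖D‖ ≤ ‖Δ‖ := by
  rw [← l2_opNorm_conjTranspose D, ← l2_opNorm_conjTranspose Δ, conjTranspose_eq_transpose_of_trivial,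
    conjTranspose_eq_transpose_of_trivial, l2_opNorm_def]
  refine ContinuousLinearMap.opNorm_le_bound _ (norm_nonneg _) fun x => ?_
  refine le_trans ?_ (l2_opNorm_mulVec Δᵀ x)
  refine le_of_sq_le_sq ?_ (norm_nonneg _)
  rw [← real_inner_self_eq_norm_sq, ← real_inner_self_eq_norm_sq]
  exact dotProduct_self_le_of_posSemidef h x.ofLp

theorem l2_opNorm_sub_mul_le {n T s : ℕ} {X₁ D₀ : Matrix (Fin n) (Fin T) ℝ}
    {Δ : Matrix (Fin n) (Fin s) ℝ} (h : ‖D₀‖ ≤ ‖Δ‖) (N : Matrix (Fin T) (Fin n) ℝ) :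
    ‖(X₁ - D₀) * N‖ ≤ dataBound X₁ Δ N := by
  rw [Matrix.sub_mul]
  refine (norm_sub_le _ _).trans (add_le_add_right ((l2_opNorm_mul _ _).trans ?_) _)
  gcongr

theorem two_mul_norm_mul_sub_mul_le {n T s : ℕ} {X₁ D₀ : Matrix (Fin n) (Fin T) ℝ}
    {Δ : Matrix (Fin n) (Fin s) ℝ} (h : ‖D₀‖ ≤ ‖Δ‖) (S : Matrix (Fin n) (Fin n) ℝ)
    (L : Matrix (Fin T) (Fin n) ℝ) :
    2 * ‖S * ((X₁ - D₀) * L)‖ ≤ omegaTwo S X₁ L Δ := by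
  have h1 : ‖S * ((X₁ - D₀) * L)‖ ≤ ‖S * X₁ * L‖ + ‖S‖ * ‖Δ‖ * ‖L‖ := by
    rw [Matrix.sub_mul, Matrix.mul_sub, ← Matrix.mul_assoc]
    refine (norm_sub_le _ _).trans (add_le_add_right ?_ _)
    calc ‖S * (D₀ * L)‖ ≤ ‖S‖ * (‖D₀‖ * ‖L‖) :=
          (l2_opNorm_mul _ _).trans (by gcongr; exact l2_opNorm_mul _ _)
      _ ≤ ‖S‖ * (‖Δ‖ * ‖L‖) := by gcongr
      _ = ‖S‖ * ‖Δ‖ * ‖L‖ := by ring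
  rw [omegaTwo]
  linarith

/-- The quadratic form of the linear matrix inequality, with the unknown noise matrix `D₀` in place of
its bound `Δ`. -/
theorem two_mul_dotProduct_sub_mul_le {n T s : ℕ} {X₁ D₀ : Matrix (Fin n) (Fin T) ℝ}
    {Δ : Matrix (Fin n) (Fin s) ℝ} (hnoise : (Δ * Δᵀ - D₀ * D₀ᵀ).PosSemidef)
    {Ω : Matrix (Fin n) (Fin n) ℝ} {ε : ℝ} (hε : 0 < ε) {Y : Matrix (Fin T) (Fin n) ℝ}
    (hlmi : (-(designMatrix X₁ Δ Ω ε Y)).PosDef) (w : Fin n → ℝ) :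
    2 * (w ⬝ᵥ ((X₁ - D₀) * Y) *ᵥ w) ≤ -(w ⬝ᵥ Ω *ᵥ w) := by
  set y := Y *ᵥ w with hy
  -- `ε⁻¹ • Y w` maximizes the quadratic form in the second block.
  have hq := hlmi.posSemidef.dotProduct_mulVec_nonneg (Sum.elim w (ε⁻¹ • y))
  have hΔ : w ⬝ᵥ (Δ * Δᵀ) *ᵥ w = (Δᵀ *ᵥ w) ⬝ᵥ (Δᵀ *ᵥ w) := by
    rw [← mulVec_mulVec, dotProduct_mulVec w Δ, ← mulVec_transpose]
  have hX : w ⬝ᵥ (X₁ * Y)ᵀ *ᵥ w = w ⬝ᵥ (X₁ * Y) *ᵥ w := by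
    rw [mulVec_transpose, dotProduct_comm, ← dotProduct_mulVec]
  have hYt : w ⬝ᵥ Yᵀ *ᵥ y = y ⬝ᵥ y := by
    rw [dotProduct_mulVec, vecMul_transpose]
  simp only [designMatrix, star_trivial, neg_mulVec, dotProduct_neg, fromBlocks_mulVec,
    Sum.elim_comp_inl, Sum.elim_comp_inr, sumElim_dotProduct_sumElim, add_mulVec, dotProduct_add,
    smul_mulVec, dotProduct_smul, smul_dotProduct, mulVec_smul, one_mulVec, smul_eq_mul, hX, hΔ,
    hYt, ← hy] at hq
  have hD := dotProduct_self_le_of_posSemidef hnoise w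
  have hsq : 0 ≤ (ε • (D₀ᵀ *ᵥ w) + y) ⬝ᵥ (ε • (D₀ᵀ *ᵥ w) + y) :=
    Finset.sum_nonneg fun _ _ => mul_self_nonneg _
  simp only [add_dotProduct, dotProduct_add, smul_dotProduct, dotProduct_smul, smul_eq_mul,
    dotProduct_comm y (D₀ᵀ *ᵥ w)] at hsq
  have hDY : w ⬝ᵥ (D₀ * Y) *ᵥ w = (D₀ᵀ *ᵥ w) ⬝ᵥ y := by
    rw [← mulVec_mulVec, dotProduct_mulVec, ← mulVec_transpose]
  rw [Matrix.sub_mul, sub_mulVec, dotProduct_sub, hDY]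
  have h1 : ε⁻¹ * (ε * (ε⁻¹ * (y ⬝ᵥ y))) = ε⁻¹ * (y ⬝ᵥ y) := by field_simp
  have h2 : 0 ≤ ε * ((D₀ᵀ *ᵥ w) ⬝ᵥ (D₀ᵀ *ᵥ w)) + 2 * ((D₀ᵀ *ᵥ w) ⬝ᵥ y) + ε⁻¹ * (y ⬝ᵥ y) := by
    have := mul_nonneg (inv_pos.2 hε).le hsq
    field_simp at this ⊢
    linarith
  have h3 := mul_le_mul_of_nonneg_left hD hε.le
  linarith

end MatrixInequalities

/-! ### Scalar linear comparison equations -/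

section Gronwall

open MeasureTheory Set Filter Topology

theorem gronwallBound_add {δ K ε : ℝ} (hK : K ≠ 0) (s t : ℝ) :
    gronwallBound (gronwallBound δ K ε s) K ε t = gronwallBound δ K ε (s + t) := by
  simp only [gronwallBound_of_K_ne_0 hK, mul_add, Real.exp_add]
  ring

theorem gronwallBound_neg_nonneg {δ c ε t : ℝ} (hc : 0 < c) (hδ : 0 ≤ δ) (hε : 0 ≤ ε)
    (ht : 0 ≤ t) : 0 ≤ gronwallBound δ (-c) ε t := by
  simp only [gronwallBound_of_K_ne_0 (neg_ne_zero.2 hc.ne')]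
  have h1 : Real.exp (-c * t) ≤ 1 := Real.exp_le_one_iff.2 (by nlinarith)
  have h2 : ε / -c * (Real.exp (-c * t) - 1) = ε / c * (1 - Real.exp (-c * t)) := by
    rw [div_neg]; ring
  rw [h2]
  have := sub_nonneg.2 h1
  positivity

theorem gronwallBound_neg_le {δ c ε t : ℝ} (hc : 0 < c) (hε : 0 ≤ ε) :
    gronwallBound δ (-c) ε t ≤ δ * Real.exp (-c * t) + ε / c := by
  simp only [gronwallBound_of_K_ne_0 (neg_ne_zero.2 hc.ne')]
  have h2 : ε / -c * (Real.exp (-c * t) - 1) = ε / c - ε / c * Real.exp (-c * t) := by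
    rw [div_neg]; ring
  rw [h2]
  have : 0 ≤ ε / c * Real.exp (-c * t) := by positivity
  linarith

theorem le_gronwallBound_of_integral_eq {f : ℝ → ℝ} {K ε b : ℝ} (hf : ContinuousOn f (Icc 0 b))
    (h : ∀ t ∈ Icc 0 b, f t = f 0 + ∫ r in (0 : ℝ)..t, (K * f r + ε)) :
    ∀ t ∈ Icc 0 b, f t ≤ gronwallBound (f 0) K ε t := by
  intro t₀ ht₀
  have hg : ContinuousOn (fun r => K * f r + ε) (Icc 0 b) := by fun_prop
  have hderiv : ∀ t ∈ Ico 0 b, HasDerivWithinAt f (K * f t + ε) (Ici t) t := by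
    intro t ht
    have hmem : Icc 0 b ∈ 𝓝[>] t :=
      mem_of_superset (Icc_mem_nhdsGT ht.2) (Icc_subset_Icc_left ht.1)
    have hI := (intervalIntegral.integral_hasDerivWithinAt_right (s := Ici t) (t := Ioi t)
      ((hg.mono (Icc_subset_Icc_right ht.2.le)).intervalIntegrable_of_Icc ht.1)
      ⟨Icc 0 b, hmem, hg.aestronglyMeasurable measurableSet_Icc⟩
      ((hg t (Ico_subset_Icc_self ht)).tendsto.mono_left
        (le_inf inf_le_left (le_principal_iff.2 hmem)))).const_add (f 0)
    rw [← hasDerivWithinAt_Ioi_iff_Ici] at hI ⊢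
    refine hI.congr_of_eventuallyEq ?_ (h t (Ico_subset_Icc_self ht))
    filter_upwards [hmem] with s hs using h s hs
  have := le_gronwallBound_of_liminf_deriv_right_le (δ := f 0) (K := K) (ε := ε) hf
    (fun t ht r hr => (hderiv t ht).liminf_right_slope_le hr) le_rfl (fun t _ => le_rfl) t₀ ht₀
  rwa [sub_zero] at this

theorem eq_gronwallBound_of_integral_eq {f : ℝ → ℝ} {K ε b : ℝ} (hf : ContinuousOn f (Icc 0 b))
    (h : ∀ t ∈ Icc 0 b, f t = f 0 + ∫ r in (0 : ℝ)..t, (K * f r + ε)) :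
    ∀ t ∈ Icc 0 b, f t = gronwallBound (f 0) K ε t := by
  intro t ht
  refine le_antisymm (le_gronwallBound_of_integral_eq hf h t ht) ?_
  have h2 := le_gronwallBound_of_integral_eq (f := fun t => -f t) (K := K) (ε := -ε) hf.neg
    (fun s hs => by
      rw [h s hs, neg_add, ← intervalIntegral.integral_neg]
      congr 2; ext r; ring) t ht
  have h3 : gronwallBound (-f 0) K (-ε) t = -gronwallBound (f 0) K ε t := by
    rcases eq_or_ne K 0 with rfl | hK
    · simp only [gronwallBound_K0]; ring
    · simp only [gronwallBound_of_K_ne_0 hK]; ring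
  rw [h3] at h2
  linarith

/-- `gronwallBound δ K ε` solves `f' = K f + ε`, `f 0 = δ`, in integral form. -/
theorem gronwallBound_integral_eq (δ K ε t : ℝ) :
    gronwallBound δ K ε t = δ + ∫ r in (0 : ℝ)..t, (K * gronwallBound δ K ε r + ε) := by
  have hc : Continuous (gronwallBound δ K ε) :=
    continuous_iff_continuousAt.2 fun r => (hasDerivAt_gronwallBound δ K ε r).continuousAt
  rw [intervalIntegral.integral_eq_sub_of_hasDerivAt
    (fun r _ => hasDerivAt_gronwallBound δ K ε r)
    ((by fun_prop : Continuous _).intervalIntegrable 0 t), gronwallBound_x0]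
  ring

theorem gronwallBound_neg_mono {δ c c' ε ε' t : ℝ} (hc' : 0 < c') (hcc : c ≤ c') (hδ : 0 ≤ δ)
    (hε : 0 ≤ ε) (hεε : ε ≤ ε') (ht : 0 ≤ t) :
    gronwallBound δ (-c') ε t ≤ gronwallBound δ (-c) ε' t := by
  have hd := hasDerivAt_gronwallBound δ (-c') ε
  have := le_gronwallBound_of_liminf_deriv_right_le (a := 0) (b := t) (δ := δ) (K := -c) (ε := ε')
    (fun r _ => (hd r).continuousAt.continuousWithinAt)
    (fun r _ q hq => (hd r).hasDerivWithinAt.liminf_right_slope_le hq)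
    (gronwallBound_x0 _ _ _).le (fun r hr => by
      have := gronwallBound_neg_nonneg (t := r) hc' hδ hε hr.1
      nlinarith) t ⟨ht, le_rfl⟩
  rwa [sub_zero] at this

end Gronwall

/-! ### Transmission instants -/

section TriggerTimes

open Set

variable {I : Set ℝ} {τ : ℝ} {v η : ℝ → ℝ}

theorem triggerTime_add_le (k : ℕ) :
    triggerTime I τ v η k + (τ : EReal) ≤ triggerTime I τ v η (k + 1) := by
  rw [triggerTime]
  refine le_sInf ?_
  rintro _ ⟨t, ht, rfl⟩
  exact ht.2.1

theorem natCast_mul_le_triggerTime (k : ℕ) :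
    ((k * τ : ℝ) : EReal) ≤ triggerTime I τ v η k := by
  induction k with
  | zero => simp [triggerTime]
  | succ k ih =>
    refine le_trans ?_ (triggerTime_add_le k)
    have : (((k + 1 : ℕ) * τ : ℝ) : EReal) = ((k * τ : ℝ) : EReal) + (τ : EReal) := by
      rw [← EReal.coe_add, Nat.cast_succ, add_one_mul]
    rw [this]
    exact add_le_add_left ih _

theorem exists_lt_triggerTime (hτ : 0 < τ) (t : ℝ) :
    ∃ k, (t : EReal) < triggerTime I τ v η k := by
  obtain ⟨k, hk⟩ := exists_nat_gt (t / τ)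
  exact ⟨k, lt_of_lt_of_le (EReal.coe_lt_coe_iff.2 ((div_lt_iff₀ hτ).1 hk))
    (natCast_mul_le_triggerTime k)⟩

theorem triggerTime_nonneg (hτ : 0 ≤ τ) (k : ℕ) : 0 ≤ triggerTime I τ v η k :=
  le_trans (by exact_mod_cast (by positivity : (0 : ℝ) ≤ k * τ)) (natCast_mul_le_triggerTime k)

theorem exists_coe_triggerTime_of_le (hτ : 0 ≤ τ) {k : ℕ} {t : ℝ}
    (h : triggerTime I τ v η k ≤ (t : EReal)) :
    ∃ a : ℝ, triggerTime I τ v η k = (a : EReal) ∧ 0 ≤ a ∧ a ≤ t := by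
  have h0 : 0 ≤ triggerTime I τ v η k := triggerTime_nonneg hτ k
  have hcoe : ((triggerTime I τ v η k).toReal : EReal) = triggerTime I τ v η k :=
    EReal.coe_toReal (ne_top_of_le_ne_top (EReal.coe_ne_top t) h)
      (ne_bot_of_le_ne_bot EReal.zero_ne_bot h0)
  refine ⟨_, hcoe.symm, ?_, ?_⟩
  · rw [← hcoe] at h0; exact_mod_cast h0
  · rw [← hcoe] at h; exact_mod_cast h

/-- Every nonnegative time lies between two consecutive transmission instants, the second possibly `⊤`. -/
theorem exists_trigger_interval (hτ : 0 < τ) {t : ℝ} (ht : 0 ≤ t) :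
    ∃ (k : ℕ) (a : ℝ), triggerTime I τ v η k = (a : EReal) ∧ 0 ≤ a ∧ a ≤ t ∧
      (t : EReal) < triggerTime I τ v η (k + 1) := by
  classical
  have hex := exists_lt_triggerTime (I := I) (v := v) (η := η) hτ t
  obtain ⟨k, hk⟩ : ∃ k, Nat.find hex = k + 1 := by
    refine Nat.exists_eq_succ_of_ne_zero fun h0 => ?_
    have := Nat.find_spec hex
    rw [h0, triggerTime] at this
    exact absurd this (not_lt.2 (by exact_mod_cast ht))
  have hle := not_lt.1 (Nat.find_min hex (m := k) (by omega))
  obtain ⟨a, h1, h2, h3⟩ := exists_coe_triggerTime_of_le hτ.le hle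
  exact ⟨k, a, h1, h2, h3, hk ▸ Nat.find_spec hex⟩

/-- After the waiting period and before the next transmission, the triggering condition fails. -/
theorem lt_of_lt_triggerTime {k : ℕ} {t : ℝ} (ht : t ∈ I)
    (h1 : triggerTime I τ v η k + (τ : EReal) ≤ (t : EReal))
    (h2 : (t : EReal) < triggerTime I τ v η (k + 1)) : v t < η t := by
  by_contra! h
  rw [triggerTime] at h2
  exact not_le.2 h2 (sInf_le ⟨t, ⟨ht, h1, h⟩, rfl⟩)

end TriggerTimes

/-! ### Decay of the Lyapunov function along solutions -/

section Decay

open MeasureTheory Set Filter Topology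

variable {E : Type*} [NormedAddCommGroup E] [InnerProductSpace ℝ E] [CompleteSpace E]

/-- Decay of `V = ⟪x, S x⟫` during a waiting period that starts at `a`. The term `ν ≥ 0` plays no role
in the dynamics of `x`; it only brings the bound into the form of the common majorant of `V` and of the
threshold. -/
theorem quadratic_le_gronwallBound_of_le_waitingTime {S Φ N : E →L[ℝ] E}
    (hS : ∀ u v, inner ℝ (S u) v = inner ℝ u (S v)) {ω₁ ω₂ σ cA cΦ c : ℝ}
    (hΦ : ∀ v, 2 * inner ℝ (S v) (Φ v) ≤ -(ω₁ * ‖v‖ ^ 2)) (hN : 2 * ‖S.comp N‖ ≤ ω₂)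
    (hσ : 0 < σ) (hσω : σ * ω₂ < ω₁) (hcA : ‖Φ - N‖ ≤ cA) (hcΦ : ‖Φ‖ ≤ cΦ)
    (hc : ∀ v, c * inner ℝ v (S v) ≤ (ω₁ - σ * ω₂) / 2 * ‖v‖ ^ 2)
    {x d : ℝ → E} {a b D δ ν : ℝ} (hν : 0 ≤ ν)
    (hxc : ContinuousOn x (Icc a b)) (hd : IntervalIntegrable d volume a b)
    (hD : ∀ r ∈ Icc a b, ‖d r‖ ≤ D) (hb : b - a ≤ waitingTime cA cΦ σ)
    (hx : ∀ t ∈ Icc a b, x t = x a + ∫ r in a..t, (Φ (x r) + N (x a - x r) + d r))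
    (ha : inner ℝ (x a) (S (x a)) ≤ δ) :
    ∀ t ∈ Icc a b, inner ℝ (x t) (S (x t)) ≤
      gronwallBound δ (-c)
        ((σ * ω₂ + 2 * ‖S‖) ^ 2 / (2 * (ω₁ - σ * ω₂)) * D ^ 2 + ν) (t - a) := by
  set α := ω₁ - σ * ω₂ with hα
  set β := σ * ω₂ + 2 * ‖S‖ with hβ
  have hα0 : 0 < α := sub_pos.2 hσω
  have hω₂ : 0 ≤ ω₂ := le_trans (by positivity) hN
  have hwc : ContinuousOn (fun r => Φ (x r) + N (x a - x r)) (Icc a b) := by fun_prop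
  have hflow : ∀ t ∈ Icc a b, ∀ z ∈ Icc t b,
      x z = x t + ∫ r in t..z, (Φ (x r) + N (x a - x r) + d r) := by
    intro t ht z hz
    have hint : IntervalIntegrable (fun r => Φ (x r) + N (x a - x r) + d r) volume a b :=
      (hwc.intervalIntegrable_of_Icc (ht.1.trans ht.2)).add hd
    have hz' : z ∈ Icc a b := ⟨ht.1.trans hz.1, hz.2⟩
    rw [hx z hz', hx t ht, add_assoc, intervalIntegral.integral_add_adjacent_intervals]
    · exact hint.mono_set (by
        rw [uIcc_of_le ht.1, uIcc_of_le (ht.1.trans ht.2)]; exact Icc_subset_Icc_right ht.2)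
    · exact hint.mono_set (by
        rw [uIcc_of_le hz.1, uIcc_of_le (ht.1.trans ht.2)]; exact Icc_subset_Icc ht.1 hz.2)
  refine le_gronwallBound_of_liminf_deriv_right_le
    (f' := fun t => 2 * inner ℝ (S (x t)) (Φ (x t) + N (x a - x t)) + 2 * ‖S (x t)‖ * D)
    ?_ ?_ ha ?_
  · exact hxc.inner (S.continuous.comp_continuousOn hxc)
  · intro t ht r hr
    have hsub : Icc t b ⊆ Icc a b := Icc_subset_Icc_left ht.1
    refine (eventually_slope_quadratic_lt hS ht.2 (hxc.mono hsub) (hwc.mono hsub)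
      (hd.mono_set ?_) (fun r hr => hD r (hsub hr)) (hflow t (Ico_subset_Icc_self ht))
      hr).frequently
    rw [uIcc_of_le ht.2.le, uIcc_of_le (ht.1.trans ht.2.le)]
    exact hsub
  · intro t ht
    have ht' := Ico_subset_Icc_self ht
    have hD0 : 0 ≤ D := (norm_nonneg _).trans (hD t ht')
    have he := norm_sub_le_of_le_waitingTime hxc hD hcA hcΦ hσ hb hx ht'
    have h1 : 2 * inner ℝ (S (x t)) (N (x a - x t)) ≤ ω₂ * ‖x t‖ * (σ * (‖x t‖ + D)) := by
      rw [hS]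
      have : inner ℝ (x t) (S (N (x a - x t))) ≤ ‖x t‖ * (‖S.comp N‖ * ‖x a - x t‖) :=
        (real_inner_le_norm _ _).trans (by gcongr; exact (S.comp N).le_opNorm _)
      calc _ ≤ 2 * (‖x t‖ * (‖S.comp N‖ * ‖x a - x t‖)) := by gcongr
        _ = 2 * ‖S.comp N‖ * ‖x t‖ * ‖x a - x t‖ := by ring
        _ ≤ ω₂ * ‖x t‖ * (σ * (‖x t‖ + D)) := by gcongr
    have h2 : 2 * ‖S (x t)‖ * D ≤ 2 * (‖S‖ * ‖x t‖) * D := by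
      gcongr; exact S.le_opNorm _
    -- Young's inequality: half of the decay absorbs the term linear in `D`.
    have h3 : β * (‖x t‖ * D) ≤ α / 2 * ‖x t‖ ^ 2 + β ^ 2 / (2 * α) * D ^ 2 := by
      have : 0 ≤ (α * ‖x t‖ - β * D) ^ 2 / (2 * α) := by positivity
      have e : (α * ‖x t‖ - β * D) ^ 2 / (2 * α)
        = α / 2 * ‖x t‖ ^ 2 + β ^ 2 / (2 * α) * D ^ 2 - β * (‖x t‖ * D) := by
        field_simp; ring
      linarith
    have h4 : ω₁ * ‖x t‖ ^ 2 = α * ‖x t‖ ^ 2 + σ * ω₂ * ‖x t‖ ^ 2 := by rw [hα]; ring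
    have h5 : β * (‖x t‖ * D) = σ * ω₂ * (‖x t‖ * D) + 2 * (‖S‖ * ‖x t‖) * D := by
      rw [hβ]; ring
    have h6 := hΦ (x t)
    have h7 := hc (x t)
    rw [inner_add_right]
    linarith

end Decay

section ClosedLoop

open MeasureTheory Set Filter Topology Matrix

variable {n m : ℕ}

theorem lyapunovV_eq_inner (S : Matrix (Fin n) (Fin n) ℝ) (x : EuclideanSpace ℝ (Fin n)) :
    lyapunovV S x = inner ℝ x (toEuclideanCLM (𝕜 := ℝ) S x) :=
  (inner_toEuclideanCLM S x x).symm

theorem continuous_lyapunovV (S : Matrix (Fin n) (Fin n) ℝ) : Continuous (lyapunovV S) := by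
  simp only [funext (lyapunovV_eq_inner S)]
  fun_prop

theorem IsDisturbance.intervalIntegrable {d : ℝ → EuclideanSpace ℝ (Fin n)}
    (hd : IsDisturbance d) {a b : ℝ} (ha : 0 ≤ a) (hb : 0 ≤ b) :
    IntervalIntegrable d volume a b := by
  obtain ⟨hm, δ, hδ⟩ := hd
  have hsub : uIoc a b ⊆ Ici 0 := fun r hr => (le_min ha hb).trans hr.1.le
  rw [intervalIntegrable_iff]
  refine ⟨(hm.mono_measure (Measure.restrict_mono hsub le_rfl)).aestronglyMeasurable,
    HasFiniteIntegral.restrict_of_bounded δ (by simp [uIoc]) ?_⟩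
  filter_upwards [ae_restrict_mem measurableSet_uIoc] with r hr using hδ r (hsub hr)

theorem IsDisturbance.norm_le_supNorm {d : ℝ → EuclideanSpace ℝ (Fin n)}
    (hd : IsDisturbance d) {t r : ℝ} (hr : r ∈ Icc 0 t) : ‖d r‖ ≤ supNorm d t := by
  obtain ⟨-, δ, hδ⟩ := hd
  refine le_csSup ⟨δ, ?_⟩ (mem_image_of_mem _ hr)
  rintro _ ⟨q, hq, rfl⟩
  exact hδ q hq.1

variable {A : Matrix (Fin n) (Fin n) ℝ} {B : Matrix (Fin n) (Fin m) ℝ}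
  {K : Matrix (Fin m) (Fin n) ℝ} {S : Matrix (Fin n) (Fin n) ℝ} {τ ς ν : ℝ}
  {d x : ℝ → EuclideanSpace ℝ (Fin n)} {η : ℝ → ℝ} {I : Set ℝ}

theorem IsClosedLoopSolution.Icc_subset (h : IsClosedLoopSolution A B K S τ ς ν d I x η) {b : ℝ}
    (hb : b ∈ I) : Icc 0 b ⊆ I :=
  h.ordConnected.out h.zero_mem hb

/-- The threshold is the explicit solution of `η' = -ς η + ν`. -/
theorem IsClosedLoopSolution.threshold_eq (h : IsClosedLoopSolution A B K S τ ς ν d I x η) :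
    EqOn η (gronwallBound (η 0) (-ς) ν) I := fun t ht =>
  eq_gronwallBound_of_integral_eq (h.continuousOn_η.mono (h.Icc_subset ht))
    (fun s hs => h.flow_η s (h.Icc_subset ht hs)) t ⟨h.subset_Ici ht, le_rfl⟩

/-- `V` is dominated by the solution of `z' = -c z + γ D² + ν`, `z 0 = η 0`, where `D` is the size of
the disturbance up to the time considered. The threshold itself is not a majorant of `V`, which may
exceed it during waiting periods. -/
theorem IsClosedLoopSolution.lyapunovV_le (h : IsClosedLoopSolution A B K S τ ς ν d I x η)
    (hd : IsDisturbance d) {ω₁ ω₂ σ cA cΦ c : ℝ}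
    (hS : ∀ u v, inner ℝ (toEuclideanCLM (𝕜 := ℝ) S u) v = inner ℝ u (toEuclideanCLM (𝕜 := ℝ) S v))
    (hΦ : ∀ v, 2 * inner ℝ (toEuclideanCLM (𝕜 := ℝ) S v) (toEuclideanCLM (𝕜 := ℝ) (A + B * K) v)
      ≤ -(ω₁ * ‖v‖ ^ 2)) (hN : 2 * ‖S * (B * K)‖ ≤ ω₂)
    (hσ : 0 < σ) (hσω : σ * ω₂ < ω₁) (hcA : ‖A‖ ≤ cA) (hcΦ : ‖A + B * K‖ ≤ cΦ)
    (hc0 : 0 < c)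
    (hc : ∀ v, c * lyapunovV S v ≤ (ω₁ - σ * ω₂) / 2 * ‖v‖ ^ 2)
    (hτ : τ = waitingTime cA cΦ σ) (hcς : c ≤ ς) (hν : 0 ≤ ν) (hη : 0 ≤ η 0)
    {t : ℝ} (ht : t ∈ I) :
    lyapunovV S (x t) ≤ gronwallBound (η 0) (-c)
      ((σ * ω₂ + 2 * ‖S‖) ^ 2 / (2 * (ω₁ - σ * ω₂)) * supNorm d t ^ 2 + ν) t := by
  set D := supNorm d t
  set γ := (σ * ω₂ + 2 * ‖S‖) ^ 2 / (2 * (ω₁ - σ * ω₂)) with hγ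
  set v : ℝ → ℝ := fun r => lyapunovV S (x r) with hv
  have hα : 0 < ω₁ - σ * ω₂ := sub_pos.2 hσω
  have hγ0 : 0 ≤ γ := by positivity
  have hτ0 : 0 < τ := hτ ▸ waitingTime_pos ((norm_nonneg _).trans hcA) hσ
  have hI := h.Icc_subset ht
  have hvc : ContinuousOn v (Icc 0 t) :=
    (continuous_lyapunovV S).comp_continuousOn (h.continuousOn_x.mono hI)
  have hηz : ∀ r ∈ Icc 0 t, η r ≤ gronwallBound (η 0) (-c) (γ * D ^ 2 + ν) r := fun r hr => by
    rw [h.threshold_eq (hI hr)]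
    exact gronwallBound_neg_mono (hc0.trans_le hcς) hcς hη hν
      (le_add_of_nonneg_left (by positivity)) hr.1
  have key : ∀ k, ∀ r ∈ Icc 0 t, (r : EReal) ≤ triggerTime I τ v η k →
      v r ≤ gronwallBound (η 0) (-c) (γ * D ^ 2 + ν) r := by
    intro k
    induction k with
    | zero =>
      intro r hr hr0
      have : r = 0 := le_antisymm (by simpa [triggerTime] using hr0) hr.1
      rw [this, gronwallBound_x0]
      exact h.init
    | succ k ih =>
      intro r hr hrk
      rcases le_total (r : EReal) (triggerTime I τ v η k) with hle | hle
      · exact ih r hr hle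
      obtain ⟨a, hak, ha0, har⟩ := exists_coe_triggerTime_of_le hτ0.le hle
      have hat : a ∈ Icc 0 t := ⟨ha0, har.trans hr.2⟩
      rcases le_or_gt r (a + τ) with hrτ | hrτ
      · have hsub : Icc a r ⊆ Icc 0 t := Icc_subset_Icc ha0 hr.2
        have := quadratic_le_gronwallBound_of_le_waitingTime
          (S := toEuclideanCLM (𝕜 := ℝ) S) (Φ := toEuclideanCLM (𝕜 := ℝ) (A + B * K))
          (N := toEuclideanCLM (𝕜 := ℝ) (B * K)) (x := x) (d := d) (a := a) (b := r) (D := D)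
          (δ := gronwallBound (η 0) (-c) (γ * D ^ 2 + ν) a) (ν := ν) (c := c) (ω₂ := ω₂)
          (cA := cA) (cΦ := cΦ) hS hΦ
          (by
            rw [← l2_opNorm_toEuclideanCLM, map_mul] at hN
            exact hN) hσ hσω
          (by rw [← map_sub, add_sub_cancel_right]; exact hcA) hcΦ
          (fun v => by rw [← lyapunovV_eq_inner]; exact hc v) hν
          (h.continuousOn_x.mono (hsub.trans hI)) (hd.intervalIntegrable ha0 hr.1)
          (fun q hq => hd.norm_le_supNorm (hsub hq)) (by rw [← hτ]; linarith)
          (fun q hq => h.flow_x k a hak q (hI (hsub hq)) hq.1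
            ((EReal.coe_le_coe_iff.2 hq.2).trans hrk))
          (by rw [← lyapunovV_eq_inner]; exact ih a hat hak.ge) r ⟨har, le_rfl⟩
        rw [← lyapunovV_eq_inner, l2_opNorm_toEuclideanCLM, ← hγ, gronwallBound_add (neg_ne_zero.2 hc0.ne'),
          add_sub_cancel] at this
        exact this
      -- The triggering condition fails strictly before `r`, hence `v r ≤ η r` by continuity, also
      -- when `r` is the next transmission instant.
      · have hlt : ∀ q ∈ Ioo (a + τ) r, v q ≤ η q := fun q hq =>
          (lt_of_lt_triggerTime (k := k) (τ := τ) (I := I)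
            (hI ⟨by linarith [hq.1], hq.2.le.trans hr.2⟩)
            (by rw [hak, ← EReal.coe_add]; exact EReal.coe_le_coe_iff.2 hq.1.le)
            ((EReal.coe_lt_coe_iff.2 hq.2).trans_le hrk)).le
        refine le_trans ?_ (hηz r hr)
        have hcl : r ∈ closure (Ioo (a + τ) r) := by
          rw [closure_Ioo hrτ.ne]; exact ⟨hrτ.le, le_rfl⟩
        have hsub : closure (Ioo (a + τ) r) ⊆ Icc 0 t := by
          rw [closure_Ioo hrτ.ne]; exact Icc_subset_Icc (by linarith) hr.2
        exact le_on_closure hlt (hvc.mono hsub) ((h.continuousOn_η.mono hI).mono hsub) hcl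
  obtain ⟨k, hk⟩ := exists_lt_triggerTime (I := I) (v := v) (η := η) hτ0 t
  exact key k t ⟨h.subset_Ici ht, le_rfl⟩ hk.le

end ClosedLoop

/-! ### Extension of solutions -/

section Extension

open MeasureTheory Set Filter Topology Matrix

theorem triggerTime_mono {I : Set ℝ} {τ : ℝ} {v η : ℝ → ℝ} (hτ : 0 ≤ τ) :
    Monotone (triggerTime I τ v η) := by
  refine monotone_nat_of_le_succ fun k => le_trans ?_ (triggerTime_add_le k)
  exact le_add_of_nonneg_right (by exact_mod_cast hτ)

/-- A finite transmission instant is attained: it lies in the time domain and satisfies the triggering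
condition. -/
theorem mem_of_triggerTime_succ_eq {I : Set ℝ} {τ : ℝ} {v η : ℝ → ℝ} (hI : I.OrdConnected)
    (h0 : 0 ∈ I) (hI0 : I ⊆ Ici 0) (hv : ContinuousOn v I) (hη : ContinuousOn η I) {k : ℕ} {t : ℝ}
    (ht : triggerTime I τ v η (k + 1) = (t : EReal)) :
    t ∈ I ∧ triggerTime I τ v η k + (τ : EReal) ≤ (t : EReal) ∧ η t ≤ v t := by
  rw [triggerTime] at ht
  set s := {r : ℝ | r ∈ I ∧ triggerTime I τ v η k + (τ : EReal) ≤ (r : EReal) ∧ η r ≤ v r} with hs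
  have hne : s.Nonempty := by
    rw [nonempty_iff_ne_empty]
    intro h
    rw [h, image_empty, sInf_empty] at ht
    exact EReal.coe_ne_top t ht.symm
  obtain ⟨q, hq⟩ := hne
  have hsub : Icc 0 q ⊆ I := hI.out h0 hq.1
  have hcl : IsClosed (Icc 0 q ∩ {r | η r ≤ v r}) :=
    isClosed_Icc.isClosed_le (hη.mono hsub) (hv.mono hsub)
  have hcl2 : IsClosed {r : ℝ | triggerTime I τ v η k + (τ : EReal) ≤ (r : EReal)} :=
    isClosed_le continuous_const continuous_coe_real_ereal
  have hcomp : IsCompact ((Icc 0 q ∩ {r | η r ≤ v r}) ∩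
      {r : ℝ | triggerTime I τ v η k + (τ : EReal) ≤ (r : EReal)}) :=
    (isCompact_Icc.of_isClosed_subset hcl inter_subset_left).inter_right hcl2
  obtain ⟨r, ⟨⟨⟨hr1, hr2⟩, hr3⟩, hmin⟩⟩ := hcomp.exists_isLeast
    ⟨q, ⟨⟨hI0 hq.1, le_rfl⟩, hq.2.2⟩, hq.2.1⟩
  have hrs : r ∈ s := ⟨hsub hr1, hr3, hr2⟩
  have hleast : sInf ((fun t : ℝ => (t : EReal)) '' s) = (r : EReal) := by
    refine IsLeast.csInf_eq ⟨mem_image_of_mem _ hrs, ?_⟩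
    rintro _ ⟨p, hp, rfl⟩
    refine EReal.coe_le_coe_iff.2 ?_
    rcases le_total p q with hpq | hpq
    · exact hmin ⟨⟨⟨hI0 hp.1, hpq⟩, hp.2.2⟩, hp.2.1⟩
    · exact hr1.2.trans hpq
  rw [hleast] at ht
  rw [← EReal.coe_eq_coe_iff.1 ht]
  exact hrs

/-- Causality: the transmission instants in a lower set `J` depend only on the data on `J`. -/
theorem triggerTime_eq_of_eqOn {I I' J : Set ℝ} {τ : ℝ} {v η v' η' : ℝ → ℝ} (hτ : 0 ≤ τ)
    (hI : I.OrdConnected) (h0 : 0 ∈ I) (hI0 : I ⊆ Ici 0) (hvc : ContinuousOn v I)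
    (hηc : ContinuousOn η I) (hJ : IsLowerSet J) (hIJ : I ∩ J = I' ∩ J)
    (hv : EqOn v v' (I ∩ J)) (hη : EqOn η η' (I ∩ J)) (k : ℕ) :
    ∀ t ∈ J, triggerTime I τ v η k = (t : EReal) → triggerTime I' τ v' η' k = (t : EReal) := by
  induction k with
  | zero => intro t _ ht; exact ht
  | succ k ih =>
    intro t htJ ht
    obtain ⟨htI, ht1, ht2⟩ := mem_of_triggerTime_succ_eq hI h0 hI0 hvc hηc ht
    obtain ⟨s, hs, -, hst⟩ := exists_coe_triggerTime_of_le (I := I) (v := v) (η := η) hτ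
      ((triggerTime_mono hτ k.le_succ).trans ht.le)
    have hs' := ih s (hJ hst htJ) hs
    have htIJ : t ∈ I ∩ J := ⟨htI, htJ⟩
    rw [triggerTime]
    refine IsLeast.csInf_eq ⟨mem_image_of_mem _ ⟨(hIJ ▸ htIJ).1, ?_, ?_⟩, ?_⟩
    · rw [hs', ← hs]; exact ht1
    · rw [← hv htIJ, ← hη htIJ]; exact ht2
    · rintro _ ⟨p, ⟨hp1, hp2, hp3⟩, rfl⟩
      refine EReal.coe_le_coe_iff.2 ?_
      by_contra! hpt
      have hpJ : p ∈ I ∩ J := hIJ ▸ ⟨hp1, hJ hpt.le htJ⟩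
      refine absurd (EReal.coe_lt_coe_iff.2 hpt) (not_lt.2 ?_)
      rw [← ht, triggerTime]
      refine sInf_le ⟨p, ⟨hpJ.1, ?_, ?_⟩, rfl⟩
      · rw [hs, ← hs']; exact hp2
      · rw [hv hpJ, hη hpJ]; exact hp3

variable {n m : ℕ}

/-- The right-hand side `(A + B K) x + B K (x_k - x) + d` of the closed loop along the curve `x`, as a
function of time, for the transmitted state `x_k = xk`. -/
noncomputable def closedLoopField (A : Matrix (Fin n) (Fin n) ℝ) (B : Matrix (Fin n) (Fin m) ℝ)
    (K : Matrix (Fin m) (Fin n) ℝ) (d : ℝ → EuclideanSpace ℝ (Fin n))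
    (xk : EuclideanSpace ℝ (Fin n)) (x : ℝ → EuclideanSpace ℝ (Fin n)) (r : ℝ) :
    EuclideanSpace ℝ (Fin n) :=
  Matrix.toEuclideanLin (A + B * K) (x r) + Matrix.toEuclideanLin (B * K) (xk - x r) + d r

variable {A : Matrix (Fin n) (Fin n) ℝ} {B : Matrix (Fin n) (Fin m) ℝ}
  {K : Matrix (Fin m) (Fin n) ℝ} {S : Matrix (Fin n) (Fin n) ℝ} {τ ς ν : ℝ}
  {d x x' : ℝ → EuclideanSpace ℝ (Fin n)} {η η' : ℝ → ℝ} {I I' J : Set ℝ}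

theorem IsClosedLoopSolution.mem_of_triggerTime_eq
    (h : IsClosedLoopSolution A B K S τ ς ν d I x η) {k : ℕ} {t : ℝ}
    (ht : triggerTime I τ (fun r => lyapunovV S (x r)) η k = (t : EReal)) : t ∈ I := by
  cases k with
  | zero =>
    have : t = 0 := by
      rw [triggerTime] at ht; exact_mod_cast ht.symm
    exact this ▸ h.zero_mem
  | succ k =>
    exact (mem_of_triggerTime_succ_eq h.ordConnected h.zero_mem h.subset_Ici
      ((continuous_lyapunovV S).comp_continuousOn h.continuousOn_x) h.continuousOn_η ht).1

/-- On a bounded time domain there is a last transmission instant. -/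
theorem IsClosedLoopSolution.exists_last_triggerTime (hτ : 0 < τ)
    (h : IsClosedLoopSolution A B K S τ ς ν d I x η) (hI : BddAbove I) :
    ∃ (k : ℕ) (a : ℝ), triggerTime I τ (fun r => lyapunovV S (x r)) η k = (a : EReal) ∧ a ∈ I ∧
      triggerTime I τ (fun r => lyapunovV S (x r)) η (k + 1) = ⊤ := by
  obtain ⟨b, hb⟩ := hI
  obtain ⟨k, a, hk, -, -, hlt⟩ := exists_trigger_interval (I := I)
    (v := fun r => lyapunovV S (x r)) (η := η) hτ (hb h.zero_mem)
  refine ⟨k, a, hk, h.mem_of_triggerTime_eq hk, ?_⟩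
  by_contra htop
  have hcoe := EReal.coe_toReal htop
    (ne_bot_of_le_ne_bot EReal.zero_ne_bot (triggerTime_nonneg hτ.le (k + 1)))
  have := hb (h.mem_of_triggerTime_eq hcoe.symm)
  rw [← hcoe, EReal.coe_lt_coe_iff] at hlt
  exact absurd this (not_le.2 hlt)

/-- A continuous extension `x'` of `x` to times outside the lower set `J` is a solution if there it
follows the flow from the last transmission instant `a` and triggers no transmission, except possibly at
the right end of the new domain. -/
theorem IsClosedLoopSolution.extend (hτ : 0 < τ)
    (h : IsClosedLoopSolution A B K S τ ς ν d I x η) (hJ : IsLowerSet J) (hIJ : I = I' ∩ J)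
    (hI' : I'.OrdConnected) (hI'0 : I' ⊆ Ici 0) (hx' : ContinuousOn x' I') (hxx : EqOn x x' I)
    {k₀ : ℕ} {a : ℝ}
    (hk₀ : triggerTime I τ (fun r => lyapunovV S (x r)) η k₀ = (a : EReal))
    (hlast : triggerTime I τ (fun r => lyapunovV S (x r)) η (k₀ + 1) = ⊤)
    (hflow : ∀ t ∈ I', t ∉ J → x' t = x' a + ∫ r in a..t, closedLoopField A B K d (x' a) x' r)
    (hno : ∀ s ∈ I', s ∉ J → ∀ t ∈ I', s < t → a + τ ≤ s →
      lyapunovV S (x' s) < gronwallBound (η 0) (-ς) ν s) :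
    IsClosedLoopSolution A B K S τ ς ν d I' x' (gronwallBound (η 0) (-ς) ν) := by
  set η' := gronwallBound (η 0) (-ς) ν with hη'
  have hηη : EqOn η η' I := h.threshold_eq
  have hη'c : Continuous η' :=
    continuous_iff_continuousAt.2 fun r => (hasDerivAt_gronwallBound _ _ _ r).continuousAt
  have hII' : I ⊆ I' := hIJ ▸ inter_subset_left
  have hIsubJ : I ⊆ J := hIJ ▸ inter_subset_right
  have hIinter : I ∩ J = I' ∩ J := by rw [inter_eq_left.2 hIsubJ, hIJ]
  have h0 := hII' h.zero_mem
  set v := fun r => lyapunovV S (x r) with hv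
  set v' := fun r => lyapunovV S (x' r) with hv'
  have hvc : ContinuousOn v I := (continuous_lyapunovV S).comp_continuousOn h.continuousOn_x
  have hv'c : ContinuousOn v' I' := (continuous_lyapunovV S).comp_continuousOn hx'
  have hvv : EqOn v v' I := fun r hr => by simp only [hv, hv', hxx hr]
  have hT : ∀ k, ∀ t ∈ J, triggerTime I τ v η k = (t : EReal) →
      triggerTime I' τ v' η' k = (t : EReal) :=
    triggerTime_eq_of_eqOn hτ.le h.ordConnected h.zero_mem h.subset_Ici hvc h.continuousOn_η hJ
      hIinter (hvv.mono inter_subset_left) (hηη.mono inter_subset_left)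
  have hT' : ∀ k, ∀ t ∈ J, triggerTime I' τ v' η' k = (t : EReal) →
      triggerTime I τ v η k = (t : EReal) :=
    triggerTime_eq_of_eqOn hτ.le hI' h0 hI'0 hv'c hη'c.continuousOn hJ hIinter.symm
      (hIJ ▸ hvv.symm) (hIJ ▸ hηη.symm)
  have haI : a ∈ I := h.mem_of_triggerTime_eq hk₀
  have hk₀' := hT k₀ a (hIsubJ haI) hk₀
  refine ⟨hI', h0, hI'0, hx', hη'c.continuousOn, ?_, ?_, ?_⟩
  · rw [← hxx h.zero_mem, hη', gronwallBound_x0]; exact h.init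
  · intro k tk hk t ht htk hle
    by_cases htJ : t ∈ J
    · have htI : t ∈ I := hIJ ▸ ⟨ht, htJ⟩
      have hkI := hT' k tk (hJ htk htJ) hk
      have htkI := h.mem_of_triggerTime_eq hkI
      have hle' : (t : EReal) ≤ triggerTime I τ v η (k + 1) := by
        by_contra! hlt
        obtain ⟨r, hr, -, hrt⟩ := exists_coe_triggerTime_of_le hτ.le hlt.le
        rw [hT (k + 1) r (hJ hrt htJ) hr, ← hr] at hle
        exact absurd hle (not_le.2 hlt)
      rw [← hxx htI, ← hxx htkI, h.flow_x k tk hkI t htI htk hle']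
      congr 1
      refine intervalIntegral.integral_congr fun r hr => ?_
      rw [uIcc_of_le htk] at hr
      simp only [hxx (h.ordConnected.out htkI htI hr)]
    · rcases eq_or_lt_of_le htk with rfl | hlt
      · simp
      rcases lt_trichotomy k k₀ with hkk | rfl | hkk
      · have := hle.trans (triggerTime_mono hτ.le (Nat.succ_le_of_lt hkk))
        rw [hk₀', EReal.coe_le_coe_iff] at this
        exact absurd (hJ this (hIsubJ haI)) htJ
      · obtain rfl : a = tk := EReal.coe_eq_coe_iff.1 (hk₀'.symm.trans hk)
        exact hflow t ht htJ
      · have hle2 := (triggerTime_mono (I := I') (v := v') (η := η') hτ.le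
          (Nat.succ_le_of_lt hkk)).trans hk.le
        obtain ⟨r, hr, -, hrt⟩ := exists_coe_triggerTime_of_le hτ.le hle2
        obtain ⟨hrI, hr1, hr2⟩ :=
          mem_of_triggerTime_succ_eq hI' h0 hI'0 hv'c hη'c.continuousOn hr
        by_cases hrJ : r ∈ J
        · have := hT' _ r hrJ hr
          rw [Nat.succ_eq_add_one, hlast] at this
          exact absurd this.symm (EReal.coe_ne_top r)
        · rw [hk₀', ← EReal.coe_add, EReal.coe_le_coe_iff] at hr1
          exact absurd hr2 (not_le.2 (hno r hrI hrJ t ht (hrt.trans_lt hlt) hr1))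
  · intro t _
    rw [hη', gronwallBound_x0]
    exact gronwallBound_integral_eq _ _ _ _

theorem IsClosedLoopSolution.exists_extension_of_Ico (hτ : 0 < τ) (hd : IsDisturbance d) {b : ℝ}
    (hb : 0 < b) (h : IsClosedLoopSolution A B K S τ ς ν d (Ico 0 b) x η) {M : ℝ}
    (hM : ∀ t ∈ Ico 0 b, ‖x t‖ ≤ M) :
    ∃ x' η', IsClosedLoopSolution A B K S τ ς ν d (Icc 0 b) x' η' ∧
      EqOn x' x (Ico 0 b) ∧ EqOn η' η (Ico 0 b) := by
  obtain ⟨k, a, hk, ha, hlast⟩ := h.exists_last_triggerTime hτ bddAbove_Ico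
  set w := fun r => toEuclideanCLM (𝕜 := ℝ) (A + B * K) (x r) +
    toEuclideanCLM (𝕜 := ℝ) (B * K) (x a - x r) with hw
  have hsub : Ioo a b ⊆ Ico 0 b := fun r hr => ⟨ha.1.trans hr.1.le, hr.2⟩
  have hwi : IntervalIntegrable w volume a b := by
    have hc : ContinuousOn w (Ioo a b) := by
      have := h.continuousOn_x.mono hsub
      fun_prop
    rw [intervalIntegrable_iff_integrableOn_Ioo_of_le ha.2.le]
    refine ⟨hc.aestronglyMeasurable measurableSet_Ioo, HasFiniteIntegral.restrict_of_bounded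
      (‖toEuclideanCLM (𝕜 := ℝ) (A + B * K)‖ * M + ‖toEuclideanCLM (𝕜 := ℝ) (B * K)‖ * (M + M))
      (by simp) ?_⟩
    filter_upwards [ae_restrict_mem measurableSet_Ioo] with r hr
    refine (norm_add_le _ _).trans (add_le_add ?_ ?_)
    · exact (ContinuousLinearMap.le_opNorm _ _).trans (by gcongr; exact hM r (hsub hr))
    · refine (ContinuousLinearMap.le_opNorm _ _).trans ?_
      gcongr
      exact (norm_sub_le _ _).trans (add_le_add (hM a ha) (hM r (hsub hr)))
  have hgi : IntervalIntegrable (closedLoopField A B K d (x a) x) volume a b :=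
    hwi.add (hd.intervalIntegrable ha.1 hb.le)
  set F := fun t => x a + ∫ r in a..t, closedLoopField A B K d (x a) x r with hF
  have hFc : ContinuousOn F (Icc a b) := by
    have := intervalIntegral.continuousOn_primitive_interval
      (f := closedLoopField A B K d (x a) x) (μ := volume) (a := a) (b := b)
      (by
        rw [uIcc_of_le ha.2.le, integrableOn_Icc_iff_integrableOn_Ioc]
        exact (intervalIntegrable_iff_integrableOn_Ioc_of_le ha.2.le).1 hgi)
    rw [uIcc_of_le ha.2.le] at this
    exact continuousOn_const.add this
  set x' := Function.update x b (F b) with hx'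
  have hx'b : x' b = F b := Function.update_self ..
  have hxx : EqOn x x' (Ico 0 b) := fun t ht => (Function.update_of_ne ht.2.ne _ _).symm
  have hx'F : EqOn x' F (Icc a b) := by
    intro t ht
    rcases eq_or_lt_of_le ht.2 with rfl | hlt
    · exact hx'b
    · have htI : t ∈ Ico 0 b := ⟨ha.1.trans ht.1, hlt⟩
      rw [← hxx htI]
      exact h.flow_x k a hk t htI ht.1 (by rw [hlast]; exact le_top)
  have hx'c : ContinuousOn x' (Icc 0 b) := by
    rw [← Icc_union_Icc_eq_Icc ha.1 ha.2.le]
    refine ContinuousOn.union_of_isClosed ?_ (hFc.congr hx'F) isClosed_Icc isClosed_Icc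
    have hs : Icc 0 a ⊆ Ico 0 b := Icc_subset_Ico_right ha.2
    exact (h.continuousOn_x.mono hs).congr (hxx.symm.mono hs)
  refine ⟨x', _, h.extend hτ (J := Iio b) (isLowerSet_Iio b) ?_ ordConnected_Icc
    Icc_subset_Ici_self hx'c hxx hk hlast ?_ ?_, hxx.symm, h.threshold_eq.symm⟩
  · ext t
    simp only [mem_Ico, mem_inter_iff, mem_Icc, mem_Iio]
    exact ⟨fun ht => ⟨⟨ht.1, ht.2.le⟩, ht.2⟩, fun ht => ⟨ht.1.1, ht.2⟩⟩
  · intro t ht htb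
    have hbt : b ≤ t := not_lt.1 htb
    have hat : a ≤ t := ha.2.le.trans hbt
    rw [hx'F ⟨hat, ht.2⟩, ← hxx ha]
    refine congrArg (x a + ·) (intervalIntegral.integral_congr_Ioo_of_le hat fun r hr => ?_)
    simp only [closedLoopField, hxx (hsub ⟨hr.1, hr.2.trans_le ht.2⟩)]
  · intro s _ hsb t ht hst
    exact absurd (hst.trans_le ht.2) hsb

theorem IsClosedLoopSolution.exists_extension_of_Icc (hτ : 0 < τ) (hd : IsDisturbance d) {b : ℝ}
    (h : IsClosedLoopSolution A B K S τ ς ν d (Icc 0 b) x η) :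
    ∃ c x' η', b < c ∧ IsClosedLoopSolution A B K S τ ς ν d (Icc 0 c) x' η' ∧
      EqOn x' x (Icc 0 b) ∧ EqOn η' η (Icc 0 b) := by
  obtain ⟨k, a, hk, ha, hlast⟩ := h.exists_last_triggerTime hτ bddAbove_Icc
  have hb0 : 0 ≤ b := ha.1.trans ha.2
  have hbI : b ∈ Icc 0 b := ⟨hb0, le_rfl⟩
  obtain ⟨hdm, δ, hδ⟩ := hd
  -- Nothing is known about `d` at negative times, so it is cut off there.
  set e : ℝ → EuclideanSpace ℝ (Fin n) := (Ici 0).indicator d with he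
  have hei : ∀ q t, IntervalIntegrable e volume q t := by
    intro q t
    rw [intervalIntegrable_iff]
    refine ⟨((aestronglyMeasurable_indicator_iff measurableSet_Ici).2
      hdm.aestronglyMeasurable).restrict,
      HasFiniteIntegral.restrict_of_bounded δ (by simp [uIoc]) (Eventually.of_forall fun r => ?_)⟩
    by_cases hr : r ∈ Ici (0 : ℝ)
    · rw [he, indicator_of_mem hr]; exact hδ r hr
    · rw [he, indicator_of_notMem hr, norm_zero]; exact (norm_nonneg _).trans (hδ 0 le_rfl)
  obtain ⟨y, hyc, hy⟩ := exists_affine_integral_solution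
    (toEuclideanCLM (𝕜 := ℝ) (A + B * K) - toEuclideanCLM (𝕜 := ℝ) (B * K)) (x b)
    (f := fun r => toEuclideanCLM (𝕜 := ℝ) (B * K) (x a) + e r) (a := b)
    (fun t => intervalIntegrable_const.add (hei b t))
  have hyb : y b = x b := by rw [hy b, intervalIntegral.integral_same, add_zero]
  have hη'c : Continuous (gronwallBound (η 0) (-ς) ν) :=
    continuous_iff_continuousAt.2 fun r => (hasDerivAt_gronwallBound _ _ _ r).continuousAt
  -- Either the waiting period is still running at `b`, or `V < η` at `b`; both persist for a while.
  obtain ⟨c, hbc, hc⟩ : ∃ c, b < c ∧ ∀ s ∈ Ioc b c, a + τ ≤ s →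
      lyapunovV S (y s) < gronwallBound (η 0) (-ς) ν s := by
    rcases lt_or_ge b (a + τ) with hlt | hge
    · exact ⟨(b + (a + τ)) / 2, by linarith, fun s hs hs' => by linarith [hs.2]⟩
    · have hb : lyapunovV S (y b) < gronwallBound (η 0) (-ς) ν b := by
        rw [hyb, ← h.threshold_eq hbI]
        exact lt_of_lt_triggerTime (v := fun r => lyapunovV S (x r)) (k := k) hbI
          (by rw [hk, ← EReal.coe_add]; exact EReal.coe_le_coe_iff.2 hge)
          (by rw [hlast]; exact EReal.coe_lt_top b)
      have hev := ((((continuous_lyapunovV S).comp hyc).tendsto b).eventually_lt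
        (hη'c.tendsto b) hb).filter_mono (nhdsWithin_le_nhds (s := Ioi b))
      obtain ⟨c, hc, hcs⟩ := mem_nhdsGT_iff_exists_Ioc_subset.1 hev
      exact ⟨c, hc, fun s hs _ => hcs hs⟩
  set x' : ℝ → EuclideanSpace ℝ (Fin n) := fun t => if t ≤ b then x t else y t with hx'
  have hxx : EqOn x x' (Icc 0 b) := fun t ht => (if_pos ht.2).symm
  have hx'y : EqOn x' y (Ici b) := by
    intro t ht
    rcases eq_or_lt_of_le (mem_Ici.1 ht) with rfl | hlt
    · rw [← hxx hbI, hyb]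
    · exact if_neg (not_le.2 hlt)
  have hx'c : ContinuousOn x' (Icc 0 c) := by
    rw [← Icc_union_Icc_eq_Icc hb0 hbc.le]
    exact (h.continuousOn_x.congr hxx.symm).union_of_isClosed
      (hyc.continuousOn.congr (hx'y.mono Icc_subset_Ici_self)) isClosed_Icc isClosed_Icc
  refine ⟨c, x', _, hbc, h.extend hτ (J := Iic b) (isLowerSet_Iic b) ?_ ordConnected_Icc
    Icc_subset_Ici_self hx'c hxx hk hlast ?_ ?_, hxx.symm, h.threshold_eq.symm⟩
  · ext t
    simp only [mem_inter_iff, mem_Icc, mem_Iic]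
    exact ⟨fun ht => ⟨⟨ht.1, ht.2.trans hbc.le⟩, ht.2⟩, fun ht => ⟨ht.1.1, ht.2⟩⟩
  · intro t ht htb
    have hbt : b < t := not_le.1 htb
    have hint : IntervalIntegrable (closedLoopField A B K e (x' a) x') volume 0 t := by
      have hx't := hx'c.mono (Icc_subset_Icc_right ht.2)
      have hw : ContinuousOn (fun r => toEuclideanCLM (𝕜 := ℝ) (A + B * K) (x' r) +
          toEuclideanCLM (𝕜 := ℝ) (B * K) (x' a - x' r)) (Icc 0 t) := by fun_prop
      exact (hw.intervalIntegrable_of_Icc ht.1).add (hei 0 t)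
    have hde : ∫ r in a..t, closedLoopField A B K d (x' a) x' r =
        ∫ r in a..t, closedLoopField A B K e (x' a) x' r := by
      refine intervalIntegral.integral_congr fun r hr => ?_
      rw [uIcc_of_le (ha.2.trans hbt.le)] at hr
      simp only [closedLoopField, he, indicator_of_mem (mem_Ici.2 (ha.1.trans hr.1))]
    have h1 : x b = x a + ∫ r in a..b, closedLoopField A B K e (x' a) x' r := by
      rw [h.flow_x k a hk b hbI ha.2 (by rw [hlast]; exact le_top)]
      refine congrArg (x a + ·) (intervalIntegral.integral_congr fun r hr => ?_)
      rw [uIcc_of_le ha.2] at hr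
      simp only [closedLoopField, he, indicator_of_mem (mem_Ici.2 (ha.1.trans hr.1)),
        hxx ha, hxx ⟨ha.1.trans hr.1, hr.2⟩]
    have h2 : y t = x b + ∫ r in b..t, closedLoopField A B K e (x' a) x' r := by
      rw [hy t]
      refine congrArg (x b + ·) (intervalIntegral.integral_congr fun r hr => ?_)
      rw [uIcc_of_le hbt.le] at hr
      simp only [closedLoopField, ← hxx ha, hx'y (mem_Ici.2 hr.1), map_sub, _root_.sub_apply,
        ← coe_toEuclideanCLM_eq_toEuclideanLin, ContinuousLinearMap.coe_coe]
      abel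
    rw [hx'y hbt.le, h2, h1, hde, hxx ha, add_assoc,
      intervalIntegral.integral_add_adjacent_intervals]
    · exact hint.mono_set (by
        rw [uIcc_of_le ha.2, uIcc_of_le ht.1]; exact Icc_subset_Icc ha.1 hbt.le)
    · exact hint.mono_set (by
        rw [uIcc_of_le hbt.le, uIcc_of_le ht.1]; exact Icc_subset_Icc_left hb0)
  · intro s hs hsb t _ _ hst
    have hbs : b < s := not_le.1 hsb
    rw [hx'y hbs.le]
    exact hc s ⟨hbs, hs.2⟩ hst

theorem IsMaximalSolution.eq_Ici (hτ : 0 < τ) (hd : IsDisturbance d)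
    (h : IsMaximalSolution A B K S τ ς ν d I x η) {M : ℝ} (hM : ∀ t ∈ I, ‖x t‖ ≤ M) :
    I = Ici 0 := by
  obtain ⟨hsol, hmax⟩ := h
  by_contra hne
  have hbdd : BddAbove I := by
    by_contra hunb
    refine hne (subset_antisymm hsol.subset_Ici fun t ht => ?_)
    obtain ⟨s, hs, hts⟩ := not_bddAbove_iff.1 hunb t
    exact hsol.Icc_subset hs ⟨ht, hts.le⟩
  obtain ⟨b, hlub⟩ : ∃ b, IsLUB I b := ⟨_, isLUB_csSup ⟨0, hsol.zero_mem⟩ hbdd⟩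
  by_cases hb : b ∈ I
  · obtain rfl : I = Icc 0 b := subset_antisymm (fun t ht => ⟨hsol.subset_Ici ht, hlub.1 ht⟩)
      (hsol.Icc_subset hb)
    obtain ⟨c, x', η', hbc, h', hx, hη⟩ := hsol.exists_extension_of_Icc hτ hd
    have heq := hmax _ x' η' h' (Icc_subset_Icc_right hbc.le) hx.symm hη.symm
    have hc : c ∈ Icc 0 b := heq ▸ ⟨(hsol.subset_Ici hb).trans hbc.le, le_rfl⟩
    exact absurd hc.2 (not_le.2 hbc)
  · have hI : I = Ico 0 b := by
      refine subset_antisymm (fun t ht => ⟨hsol.subset_Ici ht,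
        lt_of_le_of_ne (hlub.1 ht) fun h => hb (h ▸ ht)⟩) fun t ht => ?_
      obtain ⟨s, hs, hts, -⟩ := hlub.exists_between ht.2
      exact hsol.Icc_subset hs ⟨ht.1, hts.le⟩
    rw [hI] at hsol hmax hM hb
    obtain ⟨x', η', h', hx, hη⟩ := hsol.exists_extension_of_Ico hτ hd hsol.zero_mem.2 hM
    have heq := hmax _ x' η' h' Ico_subset_Icc_self hx.symm hη.symm
    exact hb (heq ▸ ⟨hsol.zero_mem.2.le, le_rfl⟩)

end Extension

/-! ### From the Lyapunov estimate to practical input-to-state stability -/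

section Estimate

open Matrix Set

theorem supNorm_nonneg {n : ℕ} (d : ℝ → EuclideanSpace ℝ (Fin n)) (t : ℝ) : 0 ≤ supNorm d t := by
  refine Real.sSup_nonneg ?_
  rintro _ ⟨r, -, rfl⟩
  exact norm_nonneg _

theorem supNorm_le {n : ℕ} {d : ℝ → EuclideanSpace ℝ (Fin n)} {δ t : ℝ} (ht : 0 ≤ t)
    (hδ : ∀ r, 0 ≤ r → ‖d r‖ ≤ δ) : supNorm d t ≤ δ := by
  refine csSup_le ((nonempty_Icc.2 ht).image _) ?_
  rintro _ ⟨r, hr, rfl⟩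
  exact hδ r hr.1

theorem norm_le_pairNorm {n : ℕ} (x : EuclideanSpace ℝ (Fin n)) (r : ℝ) : ‖x‖ ≤ pairNorm x r :=
  Real.le_sqrt_of_sq_le (le_add_of_nonneg_right (sq_nonneg r))

theorem sqrt_le_pairNorm {n : ℕ} (x : EuclideanSpace ℝ (Fin n)) (r : ℝ) : √r ≤ pairNorm x √r :=
  Real.le_sqrt_of_sq_le (le_add_of_nonneg_left (sq_nonneg _))

theorem pairNorm_sqrt_le {n : ℕ} {x : EuclideanSpace ℝ (Fin n)} {lam V η η₀ c γ D ν t : ℝ}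
    (hlam : 0 < lam) (hV : lam * ‖x‖ ^ 2 ≤ V) (hη : 0 ≤ η) (hη₀ : 0 ≤ η₀) (hc : 0 < c)
    (hγ : 0 ≤ γ) (hD : 0 ≤ D) (hν : 0 ≤ ν)
    (hVb : V ≤ gronwallBound η₀ (-c) (γ * D ^ 2 + ν) t)
    (hηb : η ≤ gronwallBound η₀ (-c) (γ * D ^ 2 + ν) t) :
    pairNorm x √η ≤ √(1 + 1 / lam) *
      (Real.exp (-(c / 2) * t) * √η₀ + √(γ / c) * D + √ν / √c) := by
  have hZ := gronwallBound_neg_le (δ := η₀) (t := t) hc (by positivity : 0 ≤ γ * D ^ 2 + ν)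
  set Z := gronwallBound η₀ (-c) (γ * D ^ 2 + ν) t
  set p := Real.exp (-(c / 2) * t) * √η₀ with hp
  set q := √(γ / c) * D with hq
  set r := √ν / √c with hr
  have hp2 : p ^ 2 = η₀ * Real.exp (-c * t) := by
    rw [hp, mul_pow, Real.sq_sqrt hη₀, ← Real.exp_nat_mul, mul_comm]
    congr 2; push_cast; ring
  have hq2 : q ^ 2 = γ / c * D ^ 2 := by rw [hq, mul_pow, Real.sq_sqrt (by positivity)]
  have hr2 : r ^ 2 = ν / c := by rw [hr, div_pow, Real.sq_sqrt hν, Real.sq_sqrt hc.le]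
  have hp0 : 0 ≤ p := by positivity
  have hq0 : 0 ≤ q := by positivity
  have hr0 : 0 ≤ r := by positivity
  have hZ2 : Z ≤ (p + q + r) ^ 2 := by
    have : η₀ * Real.exp (-c * t) + (γ * D ^ 2 + ν) / c = p ^ 2 + q ^ 2 + r ^ 2 := by
      rw [hp2, hq2, hr2]; ring
    have := mul_nonneg hp0 hq0
    have := mul_nonneg hp0 hr0
    have := mul_nonneg hq0 hr0
    nlinarith
  have hx : ‖x‖ ^ 2 ≤ 1 / lam * Z := by
    rw [one_div, ← div_eq_inv_mul, le_div_iff₀ hlam]; linarith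
  rw [pairNorm, Real.sqrt_le_left (by positivity), mul_pow,
    Real.sq_sqrt (by positivity : 0 ≤ 1 + 1 / lam), Real.sq_sqrt hη]
  calc ‖x‖ ^ 2 + η ≤ (1 + 1 / lam) * Z := by linarith
    _ ≤ _ := by gcongr

/-- The plant equation at the sampling times, in matrix form. -/
theorem sampleMatrix_plant {n m T : ℕ} {A : Matrix (Fin n) (Fin n) ℝ}
    {B : Matrix (Fin n) (Fin m) ℝ} {Ts : ℝ} {uoff : ℝ → EuclideanSpace ℝ (Fin m)}
    {xoff xdot doff : ℝ → EuclideanSpace ℝ (Fin n)}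
    (hexp : ∀ j : Fin T, xdot ((j : ℕ) * Ts) =
      Matrix.toEuclideanLin A (xoff ((j : ℕ) * Ts)) +
        Matrix.toEuclideanLin B (uoff ((j : ℕ) * Ts)) + doff ((j : ℕ) * Ts)) :
    sampleMatrix T Ts xdot - sampleMatrix T Ts doff =
      A * sampleMatrix T Ts xoff + B * sampleMatrix T Ts uoff := by
  ext i j
  have := congrArg (fun z : EuclideanSpace ℝ (Fin n) => z i) (hexp j)
  change xdot _ i = (A *ᵥ (xoff _).ofLp) i + (B *ᵥ (uoff _).ofLp) i + doff _ i at this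
  change xdot _ i - doff _ i = (A *ᵥ (xoff _).ofLp) i + (B *ᵥ (uoff _).ofLp) i
  rw [this, add_sub_cancel_right]

/-- `V` decreases along the unperturbed closed loop `x' = (A + B K) x` at the rate `ω₁`. -/
theorem closedLoop_quadratic_le {n m T s : ℕ} {A : Matrix (Fin n) (Fin n) ℝ}
    {B : Matrix (Fin n) (Fin m) ℝ} {U₀ : Matrix (Fin m) (Fin T) ℝ}
    {X₀ X₁ D₀ : Matrix (Fin n) (Fin T) ℝ} (hplant : X₁ - D₀ = A * X₀ + B * U₀)
    {Δ : Matrix (Fin n) (Fin s) ℝ} (hnoise : (Δ * Δᵀ - D₀ * D₀ᵀ).PosSemidef)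
    {Ω : Matrix (Fin n) (Fin n) ℝ} (hΩ : Ω.PosDef) {ε : ℝ} (hε : 0 < ε)
    {Y : Matrix (Fin T) (Fin n) ℝ} (hlmi : (-(designMatrix X₁ Δ Ω ε Y)).PosDef)
    (hY : (X₀ * Y).PosDef) {S : Matrix (Fin n) (Fin n) ℝ} (hS : S = (X₀ * Y)⁻¹)
    {K : Matrix (Fin m) (Fin n) ℝ} (hK : K = U₀ * Y * (X₀ * Y)⁻¹)
    (v : EuclideanSpace ℝ (Fin n)) :
    2 * inner ℝ (toEuclideanCLM (𝕜 := ℝ) S v) (toEuclideanCLM (𝕜 := ℝ) (A + B * K) v)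
      ≤ -(omegaOne S Ω * ‖v‖ ^ 2) := by
  have hunit : IsUnit (X₀ * Y).det := (Matrix.isUnit_iff_isUnit_det _).1 hY.isUnit
  have hSsymm : Sᵀ = S := by
    rw [hS]; simpa using hY.inv.isHermitian.eq
  have hcl : (A + B * K) * (X₀ * Y) = (X₁ - D₀) * Y := by
    rw [hplant, hK, Matrix.add_mul, Matrix.add_mul, Matrix.mul_assoc B,
      Matrix.nonsing_inv_mul_cancel_right _ _ hunit, Matrix.mul_assoc, Matrix.mul_assoc]
  -- In the coordinate `w = S v = (X₀ Y)⁻¹ v` the closed-loop matrix becomes `(X₁ - D₀) Y`.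
  set w := S *ᵥ v.ofLp with hw
  have hv : v.ofLp = (X₀ * Y) *ᵥ w := by
    rw [hw, hS, mulVec_mulVec, Matrix.mul_nonsing_inv _ hunit, one_mulVec]
  have hin : inner ℝ (toEuclideanCLM (𝕜 := ℝ) S v) (toEuclideanCLM (𝕜 := ℝ) (A + B * K) v)
      = w ⬝ᵥ ((X₁ - D₀) * Y) *ᵥ w := by
    rw [inner_toEuclideanCLM, ofLp_toEuclideanCLM, ← hcl, ← mulVec_mulVec, ← hv]
  have hquad : v.ofLp ⬝ᵥ (S * Ω * S) *ᵥ v.ofLp = w ⬝ᵥ Ω *ᵥ w := by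
    rw [Matrix.mul_assoc, ← mulVec_mulVec, ← mulVec_mulVec, dotProduct_mulVec, ← mulVec_transpose,
      hSsymm]
  have hherm : (S * Ω * S).IsHermitian := by
    have := isHermitian_conjTranspose_mul_mul S hΩ.isHermitian
    rwa [conjTranspose_eq_transpose_of_trivial, hSsymm] at this
  have hnorm : v.ofLp ⬝ᵥ v.ofLp = ‖v‖ ^ 2 := (real_inner_self_eq_norm_sq v)
  have h1 := hherm.sInf_spectrum_mul_le v.ofLp
  rw [hquad, hnorm] at h1
  rw [hin]
  exact (two_mul_dotProduct_sub_mul_le hnoise hε hlmi w).trans (neg_le_neg h1)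

end Estimate

theorem proposition6 {n m T s : ℕ} (hn : 0 < n) (hm : 0 < m)
    -- the (unknown) plant
    (A : Matrix (Fin n) (Fin n) ℝ) (B : Matrix (Fin n) (Fin m) ℝ)
    -- the off-line experiment
    (Ts : ℝ) (hTs : 0 < Ts) (uoff : ℝ → EuclideanSpace ℝ (Fin m))
    (xoff xdot doff : ℝ → EuclideanSpace ℝ (Fin n))
    (hexp : ∀ j : Fin T, xdot ((j : ℕ) * Ts) =
      Matrix.toEuclideanLin A (xoff ((j : ℕ) * Ts)) +
        Matrix.toEuclideanLin B (uoff ((j : ℕ) * Ts)) + doff ((j : ℕ) * Ts))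
    (U₀ : Matrix (Fin m) (Fin T) ℝ) (hU₀ : U₀ = sampleMatrix T Ts uoff)
    (X₀ : Matrix (Fin n) (Fin T) ℝ) (hX₀ : X₀ = sampleMatrix T Ts xoff)
    (X₁ : Matrix (Fin n) (Fin T) ℝ) (hX₁ : X₁ = sampleMatrix T Ts xdot)
    (D₀ : Matrix (Fin n) (Fin T) ℝ) (hD₀ : D₀ = sampleMatrix T Ts doff)
    -- richness of the data, and the bound on the off-line disturbance samples
    (hrich : (Matrix.fromRows U₀ X₀).rank = m + n)
    (Δ : Matrix (Fin n) (Fin s) ℝ)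
    (hnoise : (Δ * Δ.transpose - D₀ * D₀.transpose).PosSemidef)
    -- the design of the controller
    (Ω : Matrix (Fin n) (Fin n) ℝ) (hΩ : Ω.PosDef)
    (ε : ℝ) (hε : 0 < ε) (Y : Matrix (Fin T) (Fin n) ℝ)
    (hlmi : (-(designMatrix X₁ Δ Ω ε Y)).PosDef) (hY : (X₀ * Y).PosDef)
    (S : Matrix (Fin n) (Fin n) ℝ) (hS : S = (X₀ * Y)⁻¹)
    (K : Matrix (Fin m) (Fin n) ℝ) (hK : K = U₀ * Y * (X₀ * Y)⁻¹)
    -- the data-based quantities entering the triggering rule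
    (G : Matrix (Fin T) (Fin n) ℝ) (hGU : U₀ * G = K) (hGX : X₀ * G = 1)
    (L : Matrix (Fin T) (Fin n) ℝ) (hLU : U₀ * L = K) (hLX : X₀ * L = 0)
    (J₀ : Matrix (Fin T) (Fin m) ℝ) (V₀ : Matrix (Fin T) (Fin n) ℝ)
    (hright : Matrix.fromRows U₀ X₀ * Matrix.fromCols J₀ V₀ = 1)
    (σ : ℝ) (hσ : 0 < σ) (hσω : σ * omegaTwo S X₁ L Δ < omegaOne S Ω)
    (τ : ℝ) (hτ : τ = waitingTime (dataBound X₁ Δ V₀) (dataBound X₁ Δ G) σ)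
    (ς : ℝ) (hς : 0 < ς) :
    ∃ c₁ c₂ c₃ κ : ℝ, 1 ≤ c₁ ∧ 0 < c₂ ∧ 0 < c₃ ∧ 0 < κ ∧
      ∀ ν : ℝ, 0 ≤ ν → ∃ c₄ : ℝ, 0 < c₄ ∧ c₄ * ν ≤ κ * √ν ∧
        ∀ d : ℝ → EuclideanSpace ℝ (Fin n), IsDisturbance d →
        ∀ (I : Set ℝ) (x : ℝ → EuclideanSpace ℝ (Fin n)) (η : ℝ → ℝ),
          IsClosedLoopSolution A B K S τ ς ν d I x η →
          (∀ t ∈ I, 0 ≤ η t ∧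
            pairNorm (x t) √(η t) ≤
              c₁ * Real.exp (-c₂ * t) * pairNorm (x 0) √(η 0) + c₃ * supNorm d t + c₄ * ν) ∧
          (IsMaximalSolution A B K S τ ς ν d I x η → I = Set.Ici 0) := by

  have hplant : X₁ - D₀ = A * X₀ + B * U₀ := by
    rw [hU₀, hX₀, hX₁, hD₀]; exact sampleMatrix_plant hexp
  have hDΔ : ‖D₀‖ ≤ ‖Δ‖ := l2_opNorm_le_of_posSemidef hnoise
  have hA : (X₁ - D₀) * V₀ = A := by
    rw [Matrix.fromRows_mul_fromCols, ← Matrix.fromBlocks_one, Matrix.fromBlocks_inj] at hright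
    rw [hplant, Matrix.add_mul, Matrix.mul_assoc, Matrix.mul_assoc, hright.2.1, hright.2.2.2,
      Matrix.mul_one, Matrix.mul_zero, add_zero]
  have hΦ : (X₁ - D₀) * G = A + B * K := by
    rw [hplant, Matrix.add_mul, Matrix.mul_assoc, Matrix.mul_assoc, hGU, hGX, Matrix.mul_one]
  have hBK : (X₁ - D₀) * L = B * K := by
    rw [hplant, Matrix.add_mul, Matrix.mul_assoc, Matrix.mul_assoc, hLU, hLX, Matrix.mul_zero,
      zero_add]
  have hcA : ‖A‖ ≤ dataBound X₁ Δ V₀ := hA ▸ l2_opNorm_sub_mul_le hDΔ V₀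
  have hcΦ : ‖A + B * K‖ ≤ dataBound X₁ Δ G := hΦ ▸ l2_opNorm_sub_mul_le hDΔ G
  have hN : 2 * ‖S * (B * K)‖ ≤ omegaTwo S X₁ L Δ := hBK ▸ two_mul_norm_mul_sub_mul_le hDΔ S L
  have hSpd : S.PosDef := hS ▸ hY.inv
  have hSsymm : ∀ u v, inner ℝ (Matrix.toEuclideanCLM (𝕜 := ℝ) S u) v =
      inner ℝ u (Matrix.toEuclideanCLM (𝕜 := ℝ) S v) :=
    Matrix.isSymmetric_toEuclideanLin_iff.2 hSpd.isHermitian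
  have hdecay := closedLoop_quadratic_le hplant hnoise hΩ hε hlmi hY hS hK
  set lam := sInf (spectrum ℝ S)
  have hlam : 0 < lam := hSpd.sInf_spectrum_pos hn
  have hVlam : ∀ v, lam * ‖v‖ ^ 2 ≤ lyapunovV S v := fun v => by
    rw [← real_inner_self_eq_norm_sq]
    exact hSpd.isHermitian.sInf_spectrum_mul_le v.ofLp
  have hVnorm : ∀ v, lyapunovV S v ≤ ‖S‖ * ‖v‖ ^ 2 := fun v => by
    rw [lyapunovV_eq_inner, sq, mul_left_comm]
    refine (real_inner_le_norm _ _).trans ?_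
    gcongr
    exact (Matrix.toEuclideanCLM (𝕜 := ℝ) S).le_opNorm v
  set α := omegaOne S Ω - σ * omegaTwo S X₁ L Δ with hα
  have hα0 : 0 < α := sub_pos.2 hσω
  set γ := (σ * omegaTwo S X₁ L Δ + 2 * ‖S‖) ^ 2 / (2 * α) with hγ
  have hγ0 : 0 ≤ γ := by positivity
  set c := min ς (α / (2 * (‖S‖ + 1))) with hc
  have hc0 : 0 < c := lt_min hς (by positivity)
  have hcV : ∀ v, c * lyapunovV S v ≤ α / 2 * ‖v‖ ^ 2 := fun v => by
    calc c * lyapunovV S v ≤ α / (2 * (‖S‖ + 1)) * ((‖S‖ + 1) * ‖v‖ ^ 2) := by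
          have h1 := hVnorm v
          have h2 := hVlam v
          have h3 : 0 ≤ lyapunovV S v := le_trans (by positivity) h2
          gcongr
          · exact min_le_right _ _
          · linarith [sq_nonneg ‖v‖]
      _ = α / 2 * ‖v‖ ^ 2 := by field_simp
  have hτ0 : 0 < τ := hτ ▸ waitingTime_pos ((norm_nonneg _).trans hcA) hσ
  set q := √(1 + 1 / lam) with hq
  have hq1 : 1 ≤ q := Real.one_le_sqrt.2 (le_add_of_nonneg_right (by positivity))
  have hq0 : 0 < q := one_pos.trans_le hq1
  refine ⟨q, c / 2, q * √(γ / c) + 1, q / √c, hq1, by positivity, by positivity, by positivity,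
    fun ν hν => ?_⟩
  -- For `ν = 0` any positive `c₄` will do.
  obtain ⟨c₄, hc₄, hc₄ν⟩ : ∃ c₄ : ℝ, 0 < c₄ ∧ c₄ * ν = q / √c * √ν := by
    rcases hν.eq_or_lt with rfl | hν0
    · exact ⟨1, one_pos, by simp⟩
    · have hs : 0 < √ν := Real.sqrt_pos.2 hν0
      refine ⟨q / √c / √ν, by positivity, ?_⟩
      rw [div_mul_eq_mul_div, div_eq_iff hs.ne', mul_assoc, Real.mul_self_sqrt hν]
  refine ⟨c₄, hc₄, hc₄ν.le, fun d hd I x η h => ?_⟩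
  have hη0 : 0 ≤ η 0 := (le_trans (by positivity) (hVlam (x 0))).trans h.init
  have hbound : ∀ t ∈ I, 0 ≤ η t ∧ pairNorm (x t) √(η t) ≤
      q * Real.exp (-(c / 2) * t) * pairNorm (x 0) √(η 0) + (q * √(γ / c) + 1) * supNorm d t
        + c₄ * ν := by
    intro t ht
    have ht0 : 0 ≤ t := h.subset_Ici ht
    have hηt : 0 ≤ η t := by
      rw [h.threshold_eq ht]; exact gronwallBound_neg_nonneg hς hη0 hν ht0
    refine ⟨hηt, ?_⟩
    have hD := supNorm_nonneg d t
    have h1 := pairNorm_sqrt_le hlam (hVlam (x t)) hηt hη0 hc0 hγ0 hD hν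
      (h.lyapunovV_le hd hSsymm hdecay hN hσ hσω hcA hcΦ hc0 hcV hτ (min_le_left _ _) hν hη0 ht)
      (by
        rw [h.threshold_eq ht]
        exact gronwallBound_neg_mono hς (min_le_left _ _) hη0 hν
          (le_add_of_nonneg_left (by positivity)) ht0)
    have h2 : q * (Real.exp (-(c / 2) * t) * √(η 0)) ≤
        q * (Real.exp (-(c / 2) * t) * pairNorm (x 0) √(η 0)) := by
      gcongr
      exact sqrt_le_pairNorm _ _
    rw [hc₄ν]
    refine h1.trans ?_
    have h3 : q * (√ν / √c) = q / √c * √ν := by ring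
    rw [mul_add, mul_add, h3]
    linarith
  refine ⟨hbound, fun hmax => ?_⟩
  obtain ⟨δ, hδ⟩ := hd.2
  refine hmax.eq_Ici hτ0 hd (M := q * 1 * pairNorm (x 0) √(η 0) + (q * √(γ / c) + 1) * δ + c₄ * ν)
    fun t ht => ?_
  have ht0 : 0 ≤ t := h.subset_Ici ht
  have hp0 : 0 ≤ pairNorm (x 0) √(η 0) := Real.sqrt_nonneg _
  refine (norm_le_pairNorm _ √(η t)).trans ((hbound t ht).2.trans ?_)
  gcongr
  · exact Real.exp_le_one_iff.2 (by nlinarith)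
  · exact supNorm_le ht0 hδ
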